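/- An approval election consists of a finite set $C$ of $m$ candidates and a multiset $V$ of $n$ votes, each vote being a subset of $C$. The AV score of $w\subseteq C$ is $\sum_{v\in V}|v\cap w|$, and a winning $k$-committee is a $k$-element subset of $C$ whose AV score is maximum among all $k$-element subsets of $C$. For an integer $r\ge 0$, the problem $r$-Bounded Destructive Vote-Deletion-Change Bribery for AV is the following. Given an election $(C,V)$, a non-empty set $J\subseteq C$ of distinguished candidates, and positive integers $k\le |C|$ and $\ell\le |V|$, decide whether there is a sub-multiset $V'\subseteq V$ of at most $\ell$ votes such that one can replace each $v\in V'$ by a proper subset $v'\subsetneq v$ with $|v\setminus v'|\le r$ (leaving all other votes unchanged) so that, afterwards, no candidate of $J$ belongs to any winning $k$-committee. Theorem. For every $r\ge 0$, this problem can be solved in $O^*(2^n)$ time, that is, in at most $2^n\cdot p(N)$ steps, where $n=|V|$ is the number of votes, $N$ is the length of the input, and $p$ is a polynomial. More precisely, there are one program of a unit-cost random access machine, whose only arithmetic operations are increment and decrement, and one polynomial $p$ such that for every $r\ge 0$ the program, given $r$ as a single input word together with $k$, $\ell$, $n$, $m$ and the $0/1$ membership tables of $J$ and of the votes, halts within $2^n\cdot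 p(N)$ steps with the correct answer, where $N=5+m+nm$ is the number of input words. -/

import Mathlib

/-! ### Approval voting and destructive bribery by deleting approvals -/

namespace ApprovalBribery

/-- The AV score of a committee `w`: the sum of `|v ∩ w|` over all votes `v`.  The multiset of
votes is an indexed family, so equal votes cast by different voters are counted separately. -/
def avScore {C ι : Type} [DecidableEq C] [Fintype ι] (V : ι → Finset C) (w : Finset C) : ℕ :=
  ∑ i, (V i ∩ w).card

/-- `w` is a winning `k`-committee: a `k`-subset of the candidates of maximum AV score. -/
def IsWinningCommittee {C ι : Type} [DecidableEq C] [Fintype ι]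
    (V : ι → Finset C) (k : ℕ) (w : Finset C) : Prop :=
  w.card = k ∧ ∀ w' : Finset C, w'.card = k → avScore V w' ≤ avScore V w

/-- The Hamming distance of two votes. -/
def voteDist {C : Type} [DecidableEq C] (v v' : Finset C) : ℕ :=
  (v \ v').card + (v' \ v).card

/-- A single vote deletion change: one or more candidates are removed from `v`. -/
def IsVDC {C : Type} (v v' : Finset C) : Prop :=
  v' ⊂ v

/-- An instance with `n` votes over `m` candidates, the candidates being named by `Fin m`. -/
structure Instance (n m : ℕ) where
  /-- the votes -/
  votes : Fin n → Finset (Fin m)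
  /-- the distinguished candidates -/
  J : Finset (Fin m)
  J_nonempty : J.Nonempty
  /-- the committee size -/
  k : ℕ
  k_pos : 1 ≤ k
  k_le : k ≤ m
  /-- the number of votes that may be bribed -/
  l : ℕ
  l_pos : 1 ≤ l
  l_le : l ≤ n

/-- Yes-instances of `r`-bounded destructive vote deletion change bribery for AV: a single
vote deletion change of Hamming distance at most `r` can be made at each vote of a set `S` of at
most `l` votes, all other votes staying as they are, such that afterwards no distinguished
candidate is in any winning `k`-committee. -/
def Instance.IsYes {n m : ℕ} (I : Instance n m) (r : ℕ) : Prop :=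
  ∃ (S : Finset (Fin n)) (V' : Fin n → Finset (Fin m)),
    S.card ≤ I.l ∧
    (∀ i ∈ S, IsVDC (I.votes i) (V' i) ∧ voteDist (I.votes i) (V' i) ≤ r) ∧
    (∀ i, i ∉ S → V' i = I.votes i) ∧
    ∀ w, IsWinningCommittee V' I.k w → ∀ c ∈ I.J, c ∉ w

/-- The input word list: `n`, `m`, `k`, `l`, `r`, then `m` bits for the set of distinguished
candidates, then the `n × m` matrix of approvals, row by row. -/
def Instance.encode {n m : ℕ} (I : Instance n m) (r : ℕ) : List ℕ :=
  [n, m, I.k, I.l, r]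
    ++ (List.finRange m).map (fun c => if c ∈ I.J then 1 else 0)
    ++ (List.finRange n).flatMap
        (fun i => (List.finRange m).map (fun c => if c ∈ I.votes i then 1 else 0))

end ApprovalBribery

/-! ### Random access machines

A unit-cost RAM whose only arithmetic is increment and decrement.  In `t` steps no number grows by
more than `t` plus the constants of the program, so counting each instruction as one step hides
no work in large numbers. -/

namespace RAM

/-- Registers, and memory arrays addressed by an array number and an index.  A program mentions
only finitely many registers and arrays (by fixed numbers); indices are computed. -/
structure State where
  reg : ℕ → ℕ
  mem : ℕ → ℕ → ℕ

/-- Tests: `reg x < reg y` and `reg x = reg y`. -/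
inductive Test where
  | lt (x y : ℕ)
  | eq (x y : ℕ)

def Test.Holds (s : State) : Test → Prop
  | .lt x y => s.reg x < s.reg y
  | .eq x y => s.reg x = s.reg y

/-- Elementary instructions. -/
inductive Instr where
  /-- `reg x := c` -/
  | const (x c : ℕ)
  /-- `reg x := reg y` -/
  | copy (x y : ℕ)
  /-- `reg x := reg x + 1` -/
  | inc (x : ℕ)
  /-- `reg x := reg x - 1`, where `0 - 1 = 0` -/
  | dec (x : ℕ)
  /-- `reg x := mem a (reg y)` -/
  | load (x a y : ℕ)
  /-- `mem a (reg x) := reg y` -/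
  | store (a x y : ℕ)

def State.setReg (s : State) (x v : ℕ) : State :=
  { s with reg := Function.update s.reg x v }

def State.setMem (s : State) (a i v : ℕ) : State :=
  { s with mem := Function.update s.mem a (Function.update (s.mem a) i v) }

def Instr.exec (s : State) : Instr → State
  | .const x c => s.setReg x c
  | .copy x y => s.setReg x (s.reg y)
  | .inc x => s.setReg x (s.reg x + 1)
  | .dec x => s.setReg x (s.reg x - 1)
  | .load x a y => s.setReg x (s.mem a (s.reg y))
  | .store a x y => s.setMem a (s.reg x) (s.reg y)

/-- Programs. -/
inductive Program where
  | skip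
  | instr (i : Instr)
  | seq (P Q : Program)
  | ite (b : Test) (P Q : Program)
  | while (b : Test) (P : Program)

/-- `Runs P s s' t`: started in `s`, the program `P` halts in `s'` after exactly `t` steps, where
each executed elementary instruction and each evaluated test is one step. -/
inductive Runs : Program → State → State → ℕ → Prop
  | skip (s : State) : Runs .skip s s 0
  | instr (i : Instr) (s : State) : Runs (.instr i) s (i.exec s) 1
  | seq {P Q : Program} {s s' s'' : State} {t t' : ℕ} :
      Runs P s s' t → Runs Q s' s'' t' → Runs (.seq P Q) s s'' (t + t')
  | ite_true {b : Test} {P Q : Program} {s s' : State} {t : ℕ} :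
      b.Holds s → Runs P s s' t → Runs (.ite b P Q) s s' (t + 1)
  | ite_false {b : Test} {P Q : Program} {s s' : State} {t : ℕ} :
      ¬ b.Holds s → Runs Q s s' t → Runs (.ite b P Q) s s' (t + 1)
  | while_true {b : Test} {P : Program} {s s' s'' : State} {t t' : ℕ} :
      b.Holds s → Runs P s s' t → Runs (.while b P) s' s'' t' →
      Runs (.while b P) s s'' (t + 1 + t')
  | while_false {b : Test} {P : Program} {s : State} :
      ¬ b.Holds s → Runs (.while b P) s s 1

/-- Programs are deterministic: the final state and the number of steps are determined. -/
theorem Runs.unique {P : Program} {s s₁ s₂ : State} {t₁ t₂ : ℕ}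
    (h₁ : Runs P s s₁ t₁) (h₂ : Runs P s s₂ t₂) : s₁ = s₂ ∧ t₁ = t₂ := by
  induction h₁ generalizing s₂ t₂ with
  | skip s => cases h₂; exact ⟨rfl, rfl⟩
  | instr i s => cases h₂; exact ⟨rfl, rfl⟩
  | seq _ _ ih ih' =>
    cases h₂ with
    | seq k k' =>
      obtain ⟨rfl, rfl⟩ := ih k
      obtain ⟨rfl, rfl⟩ := ih' k'
      exact ⟨rfl, rfl⟩
  | ite_true hb _ ih =>
    cases h₂ with
    | ite_true _ k => obtain ⟨rfl, rfl⟩ := ih k; exact ⟨rfl, rfl⟩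
    | ite_false hn _ => exact absurd hb hn
  | ite_false hb _ ih =>
    cases h₂ with
    | ite_true hp _ => exact absurd hp hb
    | ite_false _ k => obtain ⟨rfl, rfl⟩ := ih k; exact ⟨rfl, rfl⟩
  | while_true hb _ _ ih ih' =>
    cases h₂ with
    | while_true _ k k' =>
      obtain ⟨rfl, rfl⟩ := ih k
      obtain ⟨rfl, rfl⟩ := ih' k'
      exact ⟨rfl, rfl⟩
    | while_false hn => exact absurd hb hn
  | while_false hb =>
    cases h₂ with
    | while_true hp _ _ => exact absurd hp hb
    | while_false _ => exact ⟨rfl, rfl⟩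

/-- The initial state: the input is in array `0`, everything else is `0`. -/
def initState (x : List ℕ) : State where
  reg := fun _ => 0
  mem := fun a i => if a = 0 then x.getD i 0 else 0

/-- On input `x` the program halts within `T` steps, with `1` in register `0` if `A` holds and
with `0` in register `0` otherwise. -/
def DecidesWithin (P : Program) (x : List ℕ) (A : Prop) (T : ℕ) : Prop :=
  ∃ (s : State) (t : ℕ), Runs P (initState x) s t ∧ t ≤ T ∧
    (A → s.reg 0 = 1) ∧ (¬ A → s.reg 0 = 0)

end RAM

/-! ### Total correctness with time bounds for RAM programs -/

namespace RAM

-- By exchanging one committee member for another, no member of `J` lies in a winning `k`-committee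
-- exactly when some `k` candidates strictly outscore every member of `J`
-- (`forall_isWinningCommittee_iff`). Deleting approvals of candidates outside `J` never helps. So
-- let `T ≤ n` be the largest number such that at least `k` candidates outside `J` have `T` or more
-- approvals; the task becomes to bring every member of `J` down to at most `T - 1` approvals. If `T
-- = 0`, or if there is no such number, the answer is no.
--
-- For a fixed set `S` of `l` voters this is a bipartite degree-constrained problem: each voter in
-- `S` may lose at most `r` approvals. Hall's theorem (`exists_deletion`) and double counting
-- (`sum_approvals_sub_le`) show that it is solvable iff for every `B ⊆ S` the total excess of `J`
-- over `T - 1`, counted without the voters in `B`, is at most `(l - |B|) * r`. A larger `S`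
-- satisfying these inequalities serves as well, because its subsets of size `l` inherit them; this
-- gives `Instance.isYes_iff`.
--
-- Testing all pairs `B ⊆ S` would take about `3 ^ n` steps. Instead, the violated inequality is
-- recorded once for each of the `2 ^ n` sets `B`, and the marks are propagated to all supersets in
-- `n` rounds of `O(2 ^ n)` work. The answer is yes iff some unmarked set has at least `l` voters.
-- Since the machine can only count, a round is arranged as a perfect shuffle: the two halves of the
-- table are read sequentially and interleaved, which rotates the binary digits of the index. After
-- `n` rounds each digit has been treated once and is back in place (`shuffled_iterate_self`).

infixr:67 " ;; " => Program.seq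

@[simp] theorem State.setReg_reg (s : State) (x v y : ℕ) :
    (s.setReg x v).reg y = if y = x then v else s.reg y := by
  simp [State.setReg, Function.update_apply]

@[simp] theorem State.setReg_mem (s : State) (x v : ℕ) : (s.setReg x v).mem = s.mem := rfl

@[simp] theorem State.setMem_reg (s : State) (a i v : ℕ) : (s.setMem a i v).reg = s.reg := rfl

@[simp] theorem State.setMem_mem (s : State) (a i v b j : ℕ) :
    (s.setMem a i v).mem b j = if b = a ∧ j = i then v else s.mem b j := by
  by_cases hb : b = a
  · subst hb
    by_cases hj : j = i <;> simp [State.setMem, hj]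
  · simp [State.setMem, hb]

/-- The registers an instruction may change. -/
def Instr.regs : Instr → List ℕ
  | .const x _ => [x]
  | .copy x _ => [x]
  | .inc x => [x]
  | .dec x => [x]
  | .load x _ _ => [x]
  | .store _ _ _ => []

/-- The arrays an instruction may change. -/
def Instr.arrs : Instr → List ℕ
  | .store a _ _ => [a]
  | _ => []

/-- The registers a program may change. -/
def Program.regs : Program → List ℕ
  | .skip => []
  | .instr i => i.regs
  | .seq P Q => P.regs ++ Q.regs
  | .ite _ P Q => P.regs ++ Q.regs
  | .while _ P => P.regs

/-- The arrays a program may change. -/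
def Program.arrs : Program → List ℕ
  | .skip => []
  | .instr i => i.arrs
  | .seq P Q => P.arrs ++ Q.arrs
  | .ite _ P Q => P.arrs ++ Q.arrs
  | .while _ P => P.arrs

/-- `s'` agrees with `s` outside the registers and arrays that `P` may change. -/
structure Agree (P : Program) (s s' : State) : Prop where
  reg : ∀ x, P.regs.contains x = false → s'.reg x = s.reg x
  mem : ∀ a, P.arrs.contains a = false → s'.mem a = s.mem a

theorem Agree.refl (P : Program) (s : State) : Agree P s s := ⟨fun _ _ => rfl, fun _ _ => rfl⟩

theorem Agree.trans {P : Program} {s s' s'' : State} (h : Agree P s s') (h' : Agree P s' s'') :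
    Agree P s s'' :=
  ⟨fun x hx => (h'.reg x hx).trans (h.reg x hx), fun a ha => (h'.mem a ha).trans (h.mem a ha)⟩

theorem Agree.mono {P Q : Program} {s s' : State} (h : Agree P s s')
    (hr : ∀ x ∈ P.regs, x ∈ Q.regs) (ha : ∀ a ∈ P.arrs, a ∈ Q.arrs) : Agree Q s s' := by
  refine ⟨fun x hx => h.reg x ?_, fun a hx => h.mem a ?_⟩
  · simp only [List.contains_eq_mem, decide_eq_false_iff_not] at hx ⊢
    exact fun h' => hx (hr x h')
  · simp only [List.contains_eq_mem, decide_eq_false_iff_not] at hx ⊢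
    exact fun h' => hx (ha a h')

/-- This is the frame rule. For a concrete program the lists of written registers and arrays
evaluate, so that preservation of any other register or array is settled by `rfl` or `decide`. -/
theorem Runs.agree {P : Program} {s s' : State} {t : ℕ} (h : Runs P s s' t) : Agree P s s' := by
  induction h with
  | skip s => exact .refl _ _
  | instr i s =>
    constructor
    · intro x hx
      cases i <;> simp_all [Program.regs, Instr.regs, Instr.exec]
    · intro a ha
      cases i <;> first | rfl | (simp_all [Program.arrs, Instr.arrs, Instr.exec, State.setMem])
  | seq _ _ ih ih' =>
    exact (ih.mono (by simp +contextual [Program.regs]) (by simp +contextual [Program.arrs])).trans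
      (ih'.mono (by simp +contextual [Program.regs]) (by simp +contextual [Program.arrs]))
  | ite_true _ _ ih =>
    exact ih.mono (by simp +contextual [Program.regs]) (by simp +contextual [Program.arrs])
  | ite_false _ _ ih =>
    exact ih.mono (by simp +contextual [Program.regs]) (by simp +contextual [Program.arrs])
  | while_true _ _ _ ih ih' => exact Agree.trans (P := .while _ _) (ih.mono (fun _ h => h) (fun _ h => h)) ih'
  | while_false _ => exact .refl _ _

/-- Started in `s`, the program halts within `T` steps in a state satisfying `Q`. -/
def Tri (P : Program) (s : State) (T : ℕ) (Q : State → Prop) : Prop :=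
  ∃ (s' : State) (t : ℕ), Runs P s s' t ∧ t ≤ T ∧ Q s'

theorem Tri.mono {P : Program} {s : State} {T T' : ℕ} {Q Q' : State → Prop} (h : Tri P s T Q)
    (hT : T ≤ T') (hQ : ∀ s', Agree P s s' → Q s' → Q' s') : Tri P s T' Q' := by
  obtain ⟨s', t, hr, ht, hq⟩ := h
  exact ⟨s', t, hr, ht.trans hT, hQ s' hr.agree hq⟩

theorem Tri.time {P : Program} {s : State} {T T' : ℕ} {Q : State → Prop} (h : Tri P s T Q)
    (hT : T ≤ T') : Tri P s T' Q := h.mono hT fun _ _ h => h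

theorem Tri.skip {s : State} {T : ℕ} {Q : State → Prop} (h : Q s) : Tri .skip s T Q :=
  ⟨s, 0, .skip s, Nat.zero_le _, h⟩

theorem Tri.instr {i : Instr} {s : State} {T : ℕ} {Q : State → Prop} (h : Q (i.exec s)) :
    Tri (.instr i) s (T + 1) Q :=
  ⟨_, 1, .instr i s, by omega, h⟩

theorem Tri.seq {P P' : Program} {s : State} {T T' : ℕ} {Q R : State → Prop}
    (h : Tri P s T Q) (h' : ∀ s', Agree P s s' → Q s' → Tri P' s' T' R) :
    Tri (P ;; P') s (T + T') R := by
  obtain ⟨s', t, hr, ht, hq⟩ := h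
  obtain ⟨s'', t', hr', ht', hq'⟩ := h' s' hr.agree hq
  exact ⟨s'', _, .seq hr hr', add_le_add ht ht', hq'⟩

theorem Tri.cons {i : Instr} {P : Program} {s : State} {T : ℕ} {Q : State → Prop}
    (h : Tri P (i.exec s) T Q) : Tri (.instr i ;; P) s (T + 1) Q := by
  rw [add_comm]
  exact (Tri.instr (Q := fun s' => s' = i.exec s) (T := 0) rfl).seq fun s' _ hs => hs ▸ h

theorem Tri.ite {b : Test} {P P' : Program} {s : State} {T : ℕ} {Q : State → Prop}
    (h : b.Holds s → Tri P s T Q) (h' : ¬ b.Holds s → Tri P' s T Q) :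
    Tri (.ite b P P') s (T + 1) Q := by
  by_cases hb : b.Holds s
  · obtain ⟨s', t, hr, ht, hq⟩ := h hb
    exact ⟨s', _, .ite_true hb hr, by omega, hq⟩
  · obtain ⟨s', t, hr, ht, hq⟩ := h' hb
    exact ⟨s', _, .ite_false hb hr, by omega, hq⟩

/-- `for x := 0, 1, …, (reg y) - 1 do P`. -/
def forLoop (x y : ℕ) (P : Program) : Program :=
  .instr (.const x 0) ;; .while (.lt x y) (P ;; .instr (.inc x))

theorem Agree.setReg {P : Program} {s s' : State} (h : Agree P s s') {x v : ℕ}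
    (hx : x ∈ P.regs) : Agree P s (s'.setReg x v) := by
  refine ⟨fun y hy => ?_, h.mem⟩
  have : y ≠ x := by rintro rfl; simp_all
  simp [this, h.reg y hy]

/-- The body may write neither the counter nor the bound, so exactly `n` rounds take place. A round
costs the body, one test and one increment; the initial assignment and the failing last test account
for the final `2`. -/
theorem Tri.forLoop {x y : ℕ} {P : Program} {s : State} {n T : ℕ} (Inv : ℕ → State → Prop)
    (hy : s.reg y = n)
    (hx : (y :: P.regs).contains x = false) (hyP : P.regs.contains y = false)
    (h0 : Inv 0 (s.setReg x 0))
    (hs : ∀ i s₁, i < n → s₁.reg x = i → Agree (forLoop x y P) s s₁ → Inv i s₁ →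
      Tri P s₁ T (fun s₂ => Inv (i + 1) (s₂.setReg x (i + 1)))) :
    Tri (forLoop x y P) s (n * (T + 2) + 2) (fun s' => Inv n s') := by
  have hxy : y ≠ x := by rintro rfl; simp at hx
  have hxP : P.regs.contains x = false := by simp_all
  have hmem : x ∈ (RAM.forLoop x y P).regs := by simp [RAM.forLoop, Program.regs, Instr.regs]
  -- Induction on the number `j` of rounds still to come.
  have key : ∀ j i s₁, i + j = n → s₁.reg x = i → Agree (RAM.forLoop x y P) s s₁ → Inv i s₁ →
      Tri (.while (.lt x y) (P ;; .instr (.inc x))) s₁ (j * (T + 2) + 1)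
        (fun s' => Inv n s') := by
    intro j
    induction j with
    | zero =>
      intro i s₁ hi hix ha hI
      have hy₁ : s₁.reg y = n := by
        rw [ha.reg y (by simp_all [RAM.forLoop, Program.regs, Instr.regs]), hy]
      refine ⟨s₁, 1, .while_false ?_, by omega, ?_⟩
      · simp [Test.Holds, hy₁, hix]; omega
      · simpa [← hi] using hI
    | succ j ih =>
      intro i s₁ hi hix ha hI
      have hy₁ : s₁.reg y = n := by
        rw [ha.reg y (by simp_all [RAM.forLoop, Program.regs, Instr.regs]), hy]
      obtain ⟨s₂, t, hr, ht, hq⟩ := hs i s₁ (by omega) hix ha hI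
      have e : (Instr.inc x).exec s₂ = s₂.setReg x (i + 1) := by
        simp [Instr.exec, hr.agree.reg x hxP, hix]
      obtain ⟨s₃, t', hr', ht', hq'⟩ := ih (i + 1) (s₂.setReg x (i + 1)) (by omega) (by simp)
        ((ha.trans (hr.agree.mono (by simp +contextual [RAM.forLoop, Program.regs])
          (by simp +contextual [RAM.forLoop, Program.arrs]))).setReg hmem) hq
      refine ⟨s₃, t + 1 + 1 + t', .while_true ?_ (.seq hr (.instr _ _)) (e ▸ hr'), ?_, hq'⟩
      · simp [Test.Holds, hy₁, hix]; omega
      · rw [Nat.succ_mul]; omega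
  exact (Tri.cons (key n 0 (s.setReg x 0) (by simp) (by simp) ((Agree.refl _ _).setReg hmem) h0))

/-- `reg a := reg a + reg y`. -/
def addReg (x a y : ℕ) : Program := forLoop x y (.instr (.inc a))

/-- `reg a := reg a - reg y`. -/
def subReg (x a y : ℕ) : Program := forLoop x y (.instr (.dec a))

theorem addReg_spec {x a y : ℕ} {s : State} {T : ℕ} (hxy : x ≠ y) (hxa : x ≠ a) (hya : y ≠ a)
    (hT : 3 * s.reg y + 2 ≤ T) :
    Tri (addReg x a y) s T (fun s' => s'.reg a = s.reg a + s.reg y) := by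
  refine ((Tri.forLoop (T := 1) (fun i s₁ => s₁.reg a = s.reg a + i) rfl ?_ ?_ ?_ ?_).time
    (by omega))
  · simp [Program.regs, Instr.regs, hxy, hxa]
  · simp [Program.regs, Instr.regs, hya]
  · simp [hxa.symm]
  · intro i s₁ _ _ _ h
    refine Tri.instr ?_
    simp [hxa.symm, Instr.exec, h, add_assoc]

theorem subReg_spec {x a y : ℕ} {s : State} {T : ℕ} (hxy : x ≠ y) (hxa : x ≠ a) (hya : y ≠ a)
    (hT : 3 * s.reg y + 2 ≤ T) :
    Tri (subReg x a y) s T (fun s' => s'.reg a = s.reg a - s.reg y) := by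
  refine ((Tri.forLoop (T := 1) (fun i s₁ => s₁.reg a = s.reg a - i) rfl ?_ ?_ ?_ ?_).time
    (by omega))
  · simp [Program.regs, Instr.regs, hxy, hxa]
  · simp [Program.regs, Instr.regs, hya]
  · simp [hxa.symm]
  · intro i s₁ _ _ _ h
    refine Tri.instr ?_
    simp [hxa.symm, Instr.exec, h, Nat.sub_sub]

/-- Each level of loop nesting raises the exponent of the time bound by one; the overhead goes into
the constant. -/
theorem loop_time {n N c k a : ℕ} (hn : n ≤ N) (hN : 1 ≤ N) :
    n * (c * N ^ k + 2) + a ≤ (c + 2 + a) * N ^ (k + 1) := by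
  have h1 : 1 ≤ N ^ k := Nat.one_le_pow _ _ hN
  have h2 : N ≤ N ^ (k + 1) := Nat.le_self_pow (by omega) N
  calc n * (c * N ^ k + 2) + a ≤ N * (c * N ^ k + 2) + a * N ^ (k + 1) := by
        gcongr
        nlinarith
    _ = c * N ^ (k + 1) + 2 * N + a * N ^ (k + 1) := by ring
    _ ≤ c * N ^ (k + 1) + 2 * N ^ (k + 1) + a * N ^ (k + 1) := by gcongr
    _ = _ := by ring

end RAM

/-! ### The decision procedure -/

namespace ApprovalBribery

open RAM

/-- The input of the procedure, with total `0/1` membership tables. -/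
structure Table where
  (n m k l r : ℕ)
  /-- membership in the set of distinguished candidates -/
  dist : ℕ → ℕ
  /-- membership in the votes -/
  vote : ℕ → ℕ → ℕ

namespace Table

variable (D : Table)

/-- The number of voters outside `b` that approve `c`. -/
def column (b : ℕ → ℕ) (c : ℕ) : ℕ :=
  ∑ i ∈ Finset.range D.n, if b i = 0 ∧ D.vote i c ≠ 0 then 1 else 0

/-- The number of candidates that are not distinguished and have at least `T` approvals. -/
def above (T : ℕ) : ℕ :=
  ∑ c ∈ Finset.range D.m, if D.dist c = 0 ∧ T ≤ D.column (fun _ => 0) c then 1 else 0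

/-- The number of approvals of distinguished candidates by voters outside `b`, counted for each
candidate beyond the first `u`. -/
def excess (u : ℕ) (b : ℕ → ℕ) : ℕ :=
  ∑ c ∈ Finset.range D.m, if D.dist c = 0 then 0 else D.column b c - u

/-- The number of voters that may still be bribed besides those in `b`. -/
def slack (b : ℕ → ℕ) : ℕ := D.l - ∑ i ∈ Finset.range D.n, if b i = 0 then 0 else 1

/-- How far the voters outside `b` are from being able to remove the excess. -/
def defect (u : ℕ) (b : ℕ → ℕ) : ℕ := D.excess u b - D.slack b * D.r

theorem column_le (b : ℕ → ℕ) (c : ℕ) : D.column b c ≤ D.n := by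
  refine (Finset.sum_le_card_nsmul _ _ 1 fun i _ => ?_).trans (by simp)
  split <;> simp

theorem column_congr {b b' : ℕ → ℕ} (h : ∀ i < D.n, b i = b' i) :
    D.column b = D.column b' := by
  funext c
  exact Finset.sum_congr rfl fun i hi => by rw [h i (Finset.mem_range.1 hi)]

theorem slack_congr {b b' : ℕ → ℕ} (h : ∀ i < D.n, b i = b' i) : D.slack b = D.slack b' := by
  unfold slack
  congr 1
  exact Finset.sum_congr rfl fun i hi => by rw [h i (Finset.mem_range.1 hi)]

theorem defect_congr {u : ℕ} {b b' : ℕ → ℕ} (h : ∀ i < D.n, b i = b' i) :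
    D.defect u b = D.defect u b' := by
  simp only [defect, excess, D.slack_congr h, D.column_congr h]

/-- The state holds the input, and register `14` holds `0`. -/
structure Env (s : State) : Prop where
  n : s.reg 1 = D.n
  m : s.reg 2 = D.m
  k : s.reg 3 = D.k
  l : s.reg 4 = D.l
  r : s.reg 5 = D.r
  zero : s.reg 14 = 0
  dist : ∀ c < D.m, s.mem 0 (5 + c) = D.dist c
  vote : ∀ i < D.n, ∀ c < D.m, s.mem 0 (5 + D.m + i * D.m + c) = D.vote i c

variable {D}

/-- The registers and arrays that hold the input are not written by `P`. -/
def Keeps (P : Program) : Prop :=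
  (∀ x ∈ [1, 2, 3, 4, 5, 14], P.regs.contains x = false) ∧ P.arrs.contains 0 = false

instance (P : Program) : Decidable (Keeps P) := by unfold Keeps; infer_instance

theorem Env.agree {P : Program} {s s' : State} (h : D.Env s) (ha : Agree P s s') (hP : Keeps P) :
    D.Env s' := by
  have hr := fun x hx => ha.reg x (hP.1 x hx)
  have hm := ha.mem 0 hP.2
  constructor
  · rw [hr 1 (by simp), h.n]
  · rw [hr 2 (by simp), h.m]
  · rw [hr 3 (by simp), h.k]
  · rw [hr 4 (by simp), h.l]
  · rw [hr 5 (by simp), h.r]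
  · rw [hr 14 (by simp), h.zero]
  · rw [hm]; exact h.dist
  · rw [hm]; exact h.vote

theorem Env.instr {i : Instr} {s : State} (h : D.Env s) (hi : Keeps (.instr i)) :
    D.Env (i.exec s) :=
  h.agree (Runs.instr i s).agree hi

/-- All parameters are at most `N`. -/
structure Bounded (D : Table) (N : ℕ) : Prop where
  one : 1 ≤ N
  n : D.n ≤ N
  m : D.m ≤ N
  l : D.l ≤ N
  r : D.r ≤ N

variable {N : ℕ}

/-! ### Polynomial-time subroutines for a single set of voters -/

/-- `reg 10 := vote (reg 7) (reg 8)`. -/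
def loadVote : Program :=
  .instr (.const 10 5) ;; addReg 11 10 2 ;; forLoop 12 7 (addReg 11 10 2) ;; addReg 11 10 8 ;;
    .instr (.load 10 0 10)

theorem loadVote_spec {s : State} (hD : D.Bounded N) (he : D.Env s) (hi : s.reg 7 < D.n)
    (hc : s.reg 8 < D.m) :
    Tri loadVote s (25 * N ^ 2) (fun s' => s'.reg 10 = D.vote (s.reg 7) (s.reg 8)) := by
  obtain ⟨h1, hn, hm, hl, hr⟩ := hD
  refine (Tri.cons (i := .const 10 5) ?_).time (T := ((3 * N + 2) + ((N * ((3 * N + 2) + 2) + 2) +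
    ((3 * N + 2) + 1))) + 1) (by nlinarith)
  set s₀ := (Instr.const 10 5).exec s with hs₀
  have e₀ : D.Env s₀ := he.instr (by decide)
  refine Tri.seq (addReg_spec (by decide) (by decide) (by decide) (by rw [e₀.m]; omega)) ?_
  intro s₁ a₁ h₁
  have e₁ := e₀.agree a₁ (by decide)
  have h7 : s₁.reg 7 = s.reg 7 := by rw [a₁.reg 7 rfl]; rfl
  -- The row offset is a product, obtained by adding `m` once per preceding row.
  refine Tri.seq ((Tri.forLoop (T := 3 * N + 2) (fun i s' => s'.reg 10 = 5 + D.m + i * D.m) h7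
    rfl rfl ?_ ?_).time (by gcongr; omega)) ?_
  · simp [h₁, e₀.m]
    simp [hs₀, Instr.exec]
  · intro i s₂ _ _ a₂ h₂
    have e₂ := e₁.agree a₂ (by decide)
    refine (addReg_spec (by decide) (by decide) (by decide) (by rw [e₂.m]; omega)).mono le_rfl ?_
    intro s₃ _ h₃
    simp [h₃, h₂, e₂.m]
    ring
  · intro s₂ a₂ h₂
    have h8 : s₂.reg 8 = s.reg 8 := by rw [a₂.reg 8 rfl, a₁.reg 8 rfl]; rfl
    refine Tri.seq (addReg_spec (by decide) (by decide) (by decide) (by rw [h8]; omega)) ?_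
    intro s₃ a₃ h₃
    have e₃ := (e₁.agree a₂ (by decide)).agree a₃ (by decide)
    refine Tri.instr ?_
    simp [Instr.exec, h₃, h₂, h8, e₃.vote _ hi _ hc]

/-- `reg 10 := dist (reg 8)`. -/
def loadDist : Program :=
  .instr (.const 10 5) ;; addReg 11 10 8 ;; .instr (.load 10 0 10)

theorem loadDist_spec {s : State} (hD : D.Bounded N) (he : D.Env s) (hc : s.reg 8 < D.m) :
    Tri loadDist s (7 * N) (fun s' => s'.reg 10 = D.dist (s.reg 8)) := by
  obtain ⟨h1, hn, hm, hl, hr⟩ := hD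
  refine (Tri.cons (i := .const 10 5) ?_).time (T := (3 * N + 2 + 1) + 1) (by omega)
  refine Tri.seq (addReg_spec (by decide) (by decide) (by decide)
    (by simp [Instr.exec]; omega)) ?_
  intro s₁ a₁ h₁
  have e₁ := (he.instr (i := .const 10 5) (by decide)).agree a₁ (by decide)
  refine Tri.instr ?_
  simp [Instr.exec] at h₁
  simp [Instr.exec, h₁, e₁.dist _ hc]

/-- `reg 9 := column (mem 1) (reg 8)`. -/
def countColumn : Program :=
  .instr (.const 9 0) ;; forLoop 7 1 (.instr (.load 13 1 7) ;;
    .ite (.eq 13 14) (loadVote ;; .ite (.eq 10 14) .skip (.instr (.inc 9))) .skip)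

theorem countColumn_spec {s : State} (hD : D.Bounded N) (he : D.Env s) (hc : s.reg 8 < D.m) :
    Tri countColumn s (35 * N ^ 3) (fun s' => s'.reg 9 = D.column (s.mem 1) (s.reg 8)) := by
  have e₀ : D.Env ((Instr.const 9 0).exec s) := he.instr (by decide)
  refine (Tri.cons (i := .const 9 0) (T := D.n * (29 * N ^ 2 + 2) + 2)
    ((Tri.forLoop (T := 29 * N ^ 2) (fun i s' => s'.reg 9 =
      ∑ j ∈ Finset.range i, if s.mem 1 j = 0 ∧ D.vote j (s.reg 8) ≠ 0 then 1 else 0) e₀.n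
      rfl rfl ?_ ?_))).time ?_
  · simp [Instr.exec]
  · intro i s₁ hi hix a₁ h₁
    have e₁ := e₀.agree a₁ (by decide)
    have m₁ : s₁.mem 1 = s.mem 1 := a₁.mem 1 rfl
    have r₁ : s₁.reg 8 = s.reg 8 := a₁.reg 8 rfl
    have hN : 1 ≤ N ^ 2 := Nat.one_le_pow _ _ hD.one
    refine (Tri.cons (T := 25 * N ^ 2 + (0 + 1 + 1) + 1) ?_).time (by omega)
    have e₂ := e₁.instr (i := .load 13 1 7) (by decide)
    refine Tri.ite ?_ ?_
    · intro hb
      simp [Test.Holds, Instr.exec, e₁.zero, hix, m₁] at hb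
      refine Tri.seq (loadVote_spec hD e₂ (by simpa [Instr.exec, hix] using hi)
        (by simpa [Instr.exec, r₁] using hc)) ?_
      intro s₃ a₃ h₃
      have e₃ := e₂.agree a₃ (by decide)
      have h9 : s₃.reg 9 = s₁.reg 9 := by rw [a₃.reg 9 rfl]; rfl
      simp [Instr.exec, hix, r₁] at h₃
      refine Tri.ite ?_ ?_
      · intro ht
        simp [Test.Holds, h₃, e₃.zero] at ht
        refine Tri.skip ?_
        simp [h9, h₁, Finset.sum_range_succ, -Finset.sum_boole, ht]
      · intro ht
        simp [Test.Holds, h₃, e₃.zero] at ht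
        refine Tri.instr ?_
        simp [Instr.exec, h9, h₁, Finset.sum_range_succ, -Finset.sum_boole, ht, hb]
    · intro hb
      simp [Test.Holds, Instr.exec, e₁.zero, hix, m₁] at hb
      refine Tri.skip ?_
      simp [Instr.exec, h₁, Finset.sum_range_succ, hb, -Finset.sum_boole]
  · have := loop_time (c := 29) (k := 2) (a := 3) hD.n hD.one
    have hN : 1 ≤ N ^ 3 := Nat.one_le_pow _ _ hD.one
    norm_num at this
    omega

/-- `reg 15 := above (reg 6)`, provided that array `1` is zero. -/
def countAbove : Program :=
  .instr (.const 15 0) ;; forLoop 8 2 (loadDist ;;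
    .ite (.eq 10 14) (countColumn ;; .ite (.lt 9 6) .skip (.instr (.inc 15))) .skip)

theorem countAbove_spec {s : State} (hD : D.Bounded N) (he : D.Env s) (hz : ∀ i, s.mem 1 i = 0) :
    Tri countAbove s (55 * N ^ 4) (fun s' => s'.reg 15 = D.above (s.reg 6)) := by
  have e₀ : D.Env ((Instr.const 15 0).exec s) := he.instr (by decide)
  have hz : s.mem 1 = fun _ => 0 := funext hz
  refine (Tri.cons (i := .const 15 0) (T := D.m * (45 * N ^ 3 + 2) + 2)
    ((Tri.forLoop (T := 45 * N ^ 3) (fun i s' => s'.reg 15 = ∑ c ∈ Finset.range i,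
      if D.dist c = 0 ∧ s.reg 6 ≤ D.column (fun _ => 0) c then 1 else 0) e₀.m
      rfl rfl ?_ ?_))).time ?_
  · simp [Instr.exec]
  · intro i s₁ hi hix a₁ h₁
    have e₁ := e₀.agree a₁ (by decide)
    have m₁ : s₁.mem 1 = fun _ => 0 := (a₁.mem 1 rfl).trans hz
    have r₁ : s₁.reg 6 = s.reg 6 := a₁.reg 6 rfl
    have hN : 1 ≤ N ^ 3 := Nat.one_le_pow _ _ hD.one
    have hN' : N ≤ N ^ 3 := Nat.le_self_pow (by omega) N
    refine (Tri.seq (T' := 35 * N ^ 3 + (0 + 1 + 1) + 1)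
      (loadDist_spec hD e₁ (by omega)) ?_).time (by omega)
    intro s₂ a₂ h₂
    have e₂ := e₁.agree a₂ (by decide)
    rw [hix] at h₂
    refine Tri.ite ?_ ?_
    · intro hb
      simp [Test.Holds, e₂.zero, h₂] at hb
      have r8 : s₂.reg 8 = i := by rw [a₂.reg 8 rfl, hix]
      refine Tri.seq (countColumn_spec hD e₂ (by omega)) ?_
      intro s₃ a₃ h₃
      have h15 : s₃.reg 15 = s₁.reg 15 := by rw [a₃.reg 15 rfl, a₂.reg 15 rfl]
      have h6 : s₃.reg 6 = s.reg 6 := by rw [a₃.reg 6 rfl, a₂.reg 6 rfl, r₁]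
      rw [a₂.mem 1 rfl, m₁, r8] at h₃
      refine Tri.ite ?_ ?_
      · intro ht
        simp [Test.Holds, h₃, h6] at ht
        refine Tri.skip ?_
        simp [h15, h₁, Finset.sum_range_succ, -Finset.sum_boole, ht]
      · intro ht
        simp [Test.Holds, h₃, h6] at ht
        refine Tri.instr ?_
        simp [Instr.exec, h15, h₁, Finset.sum_range_succ, -Finset.sum_boole, ht, hb]
    · intro hb
      simp [Test.Holds, e₂.zero, h₂] at hb
      refine Tri.skip ?_
      simp [a₂.reg 15 rfl, h₁, Finset.sum_range_succ, hb, -Finset.sum_boole]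
  · have := loop_time (c := 45) (k := 3) (a := 3) hD.m hD.one
    have hN : 1 ≤ N ^ 4 := Nat.one_le_pow _ _ hD.one
    norm_num at this
    omega

/-- `T` is the largest number in `{0, …, n}` for which `k` candidates that are not distinguished
have at least `T` approvals, or `0` if there is none. -/
def IsThreshold (D : Table) (T : ℕ) : Prop :=
  T ≤ D.n ∧ (∀ T' ≤ D.n, T < T' → D.above T' < D.k) ∧ (T = 0 ∨ D.k ≤ D.above T)

/-- Compute the threshold in register `6`. -/
def threshold : Program :=
  .instr (.copy 6 1) ;; forLoop 17 1 (countAbove ;; .ite (.lt 15 3) (.instr (.dec 6)) .skip)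

theorem threshold_spec {s : State} (hD : D.Bounded N) (he : D.Env s) (hz : ∀ i, s.mem 1 i = 0) :
    Tri threshold s (65 * N ^ 5) (fun s' => D.IsThreshold (s'.reg 6)) := by
  have e₀ : D.Env ((Instr.copy 6 1).exec s) := he.instr (by decide)
  refine (Tri.cons (i := .copy 6 1) (T := D.n * (57 * N ^ 4 + 2) + 2)
    (((Tri.forLoop (T := 57 * N ^ 4) (fun i s' => s'.reg 6 ≤ D.n ∧
      (∀ T' ≤ D.n, s'.reg 6 < T' → D.above T' < D.k) ∧
        -- Either every round so far has decremented the register, or it has reached a value that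
        -- passes the test and stays there. After `n` rounds the first case means that the register
        -- is `0`.
        (s'.reg 6 + i = D.n ∨ D.k ≤ D.above (s'.reg 6))) e₀.n
      rfl rfl ?_ ?_)).mono le_rfl ?_)).time ?_
  · simp [Instr.exec, he.n]
    omega
  · intro i s₁ hi hix a₁ ⟨hle, hgt, h₁⟩
    have e₁ := e₀.agree a₁ (by decide)
    have m₁ : s₁.mem 1 = s.mem 1 := a₁.mem 1 rfl
    have hN : 1 ≤ N ^ 4 := Nat.one_le_pow _ _ hD.one
    refine (Tri.seq (T' := 0 + 1 + 1) (countAbove_spec hD e₁ (by rwa [m₁])) ?_).time (by omega)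
    intro s₂ a₂ h₂
    have e₂ := e₁.agree a₂ (by decide)
    have r6 : s₂.reg 6 = s₁.reg 6 := a₂.reg 6 rfl
    refine Tri.ite ?_ ?_
    · intro hb
      simp [Test.Holds, e₂.k, h₂] at hb
      refine Tri.instr ?_
      simp [Instr.exec, r6]
      refine ⟨by omega, fun T' hT' hT => ?_, by omega⟩
      rcases Nat.lt_or_ge (s₁.reg 6) T' with h | h
      · exact hgt T' hT' h
      · rwa [show T' = s₁.reg 6 by omega]
    · intro hb
      simp [Test.Holds, e₂.k, h₂] at hb
      refine Tri.skip ?_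
      simp [r6]
      exact ⟨hle, hgt, .inr hb⟩
  · intro s' _ ⟨h, h', h''⟩
    exact ⟨h, h', h''.imp_left (by omega)⟩
  · have := loop_time (c := 57) (k := 4) (a := 3) hD.n hD.one
    have hN : 1 ≤ N ^ 5 := Nat.one_le_pow _ _ hD.one
    norm_num at this
    omega

/-- `reg 15 := excess (reg 6) (mem 1)`. -/
def countExcess : Program :=
  .instr (.const 15 0) ;; forLoop 8 2 (loadDist ;;
    .ite (.eq 10 14) .skip (countColumn ;; subReg 11 9 6 ;; addReg 11 15 9))

theorem countExcess_spec {s : State} (hD : D.Bounded N) (he : D.Env s) (h6 : s.reg 6 ≤ N) :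
    Tri countExcess s (60 * N ^ 4) (fun s' => s'.reg 15 = D.excess (s.reg 6) (s.mem 1)) := by
  have e₀ : D.Env ((Instr.const 15 0).exec s) := he.instr (by decide)
  refine (Tri.cons (i := .const 15 0) (T := D.m * (55 * N ^ 3 + 2) + 2)
    ((Tri.forLoop (T := 55 * N ^ 3) (fun i s' => s'.reg 15 = ∑ c ∈ Finset.range i,
      if D.dist c = 0 then 0 else D.column (s.mem 1) c - s.reg 6) e₀.m
      rfl rfl ?_ ?_))).time ?_
  · simp [Instr.exec]
  · intro i s₁ hi hix a₁ h₁
    have e₁ := e₀.agree a₁ (by decide)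
    have m₁ : s₁.mem 1 = s.mem 1 := a₁.mem 1 rfl
    have r₁ : s₁.reg 6 = s.reg 6 := a₁.reg 6 rfl
    have hN : 1 ≤ N ^ 3 := Nat.one_le_pow _ _ hD.one
    have hN' : N ≤ N ^ 3 := Nat.le_self_pow (by omega) N
    refine (Tri.seq (T' := 35 * N ^ 3 + ((3 * N + 2) + (3 * N + 2)) + 1)
      (loadDist_spec hD e₁ (by omega)) ?_).time (by omega)
    intro s₂ a₂ h₂
    have e₂ := e₁.agree a₂ (by decide)
    rw [hix] at h₂
    refine Tri.ite ?_ ?_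
    · intro hb
      simp [Test.Holds, e₂.zero, h₂] at hb
      refine Tri.skip ?_
      simp [a₂.reg 15 rfl, h₁, Finset.sum_range_succ, hb, -Finset.sum_boole]
    · intro hb
      simp [Test.Holds, e₂.zero, h₂] at hb
      have r8 : s₂.reg 8 = i := by rw [a₂.reg 8 rfl, hix]
      refine Tri.seq (countColumn_spec hD e₂ (by omega)) ?_
      intro s₃ a₃ h₃
      rw [a₂.mem 1 rfl, m₁, r8] at h₃
      have h6' : s₃.reg 6 = s.reg 6 := by rw [a₃.reg 6 rfl, a₂.reg 6 rfl, r₁]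
      refine Tri.seq (subReg_spec (by decide) (by decide) (by decide) (by omega)) ?_
      intro s₄ a₄ h₄
      have h15 : s₄.reg 15 = s₁.reg 15 := by
        rw [a₄.reg 15 rfl, a₃.reg 15 rfl, a₂.reg 15 rfl]
      have hcol := D.column_le (s.mem 1) i
      have hn := hD.n
      refine (addReg_spec (by decide) (by decide) (by decide) (by omega)).mono le_rfl ?_
      intro s₅ _ h₅
      simp [h₅, h₄, h15, h₃, h6', h₁, Finset.sum_range_succ, hb, -Finset.sum_boole]
  · have := loop_time (c := 55) (k := 3) (a := 3) hD.m hD.one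
    have hN : 1 ≤ N ^ 4 := Nat.one_le_pow _ _ hD.one
    norm_num at this
    omega

/-- `reg 16 := slack (mem 1)`. -/
def countSlack : Program :=
  .instr (.copy 16 4) ;; forLoop 7 1 (.instr (.load 13 1 7) ;;
    .ite (.eq 13 14) .skip (.instr (.dec 16)))

theorem countSlack_spec {s : State} (hD : D.Bounded N) (he : D.Env s) :
    Tri countSlack s (8 * N) (fun s' => s'.reg 16 = D.slack (s.mem 1)) := by
  have e₀ : D.Env ((Instr.copy 16 4).exec s) := he.instr (by decide)
  refine (Tri.cons (i := .copy 16 4) (T := D.n * (3 + 2) + 2)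
    ((Tri.forLoop (T := 3) (fun i s' => s'.reg 16 = D.l -
      ∑ j ∈ Finset.range i, if s.mem 1 j = 0 then 0 else 1) e₀.n rfl rfl ?_ ?_))).time ?_
  · simp [Instr.exec, he.l]
  · intro i s₁ hi hix a₁ h₁
    have e₁ := e₀.agree a₁ (by decide)
    have m₁ : s₁.mem 1 = s.mem 1 := a₁.mem 1 rfl
    refine Tri.cons (T := 0 + 1 + 1) (Tri.ite ?_ ?_)
    · intro hb
      simp [Test.Holds, Instr.exec, e₁.zero, hix, m₁] at hb
      refine Tri.skip ?_
      simp [Instr.exec, h₁, Finset.sum_range_succ, hb, -Finset.sum_boole]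
    · intro hb
      simp [Test.Holds, Instr.exec, e₁.zero, hix, m₁] at hb
      refine Tri.instr ?_
      simp [Instr.exec, h₁, Finset.sum_range_succ, hb, -Finset.sum_boole]
      omega
  · have := hD.n
    have := hD.one
    omega

/-- `reg 15 := defect (reg 6) (mem 1)` and `reg 16 := slack (mem 1)`. -/
def countDefect : Program :=
  countExcess ;; countSlack ;; forLoop 17 16 (subReg 11 15 5)

theorem countDefect_spec {s : State} (hD : D.Bounded N) (he : D.Env s) (h6 : s.reg 6 ≤ N) :
    Tri countDefect s (80 * N ^ 4) (fun s' => s'.reg 15 = D.defect (s.reg 6) (s.mem 1) ∧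
      s'.reg 16 = D.slack (s.mem 1)) := by
  have hN : N ≤ N ^ 4 := Nat.le_self_pow (by omega) N
  have hN' : N * N ≤ N ^ 4 := by
    rw [← sq]; exact Nat.pow_le_pow_right hD.one (by omega)
  refine (Tri.seq (T' := 8 * N + (N * ((3 * N + 2) + 2) + 2))
    (countExcess_spec hD he h6) ?_).time (by have := hD.one; nlinarith)
  intro s₁ a₁ h₁
  have e₁ := he.agree a₁ (by decide)
  refine Tri.seq (countSlack_spec hD e₁) ?_
  intro s₂ a₂ h₂
  have e₂ := e₁.agree a₂ (by decide)
  rw [a₁.mem 1 rfl] at h₂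
  have hsl : D.slack (s.mem 1) ≤ N := (Nat.sub_le _ _).trans hD.l
  -- The product of slack and `r` is subtracted as `slack` many copies of `r`; this is polynomial
  -- because both are at most `N`.
  refine ((Tri.forLoop (T := 3 * N + 2)
    (fun i s' => s'.reg 15 = D.excess (s.reg 6) (s.mem 1) - i * D.r) h₂ rfl rfl ?_ ?_)).mono
    (by gcongr) ?_
  · simp [a₂.reg 15 rfl, h₁]
  · intro i s₃ hi hix a₃ h₃
    have e₃ := e₂.agree a₃ (by decide)
    have := hD.r
    refine (subReg_spec (by decide) (by decide) (by decide) (by rw [e₃.r]; omega)).mono le_rfl ?_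
    intro s₄ _ h₄
    simp [h₄, h₃, e₃.r, Nat.sub_sub, Nat.succ_mul]
  · intro s₃ a₃ h₃
    exact ⟨h₃, by rw [a₃.reg 16 rfl, h₂]⟩

end Table
end ApprovalBribery

/-! ### Binary digits and propagation of marks to supersets -/

namespace ApprovalBribery

open RAM

/-- The binary digits of `x`. -/
def bits (x i : ℕ) : ℕ := (x.testBit i).toNat

theorem bits_eq (x i : ℕ) : bits x i = x / 2 ^ i % 2 := by
  rw [bits, Nat.toNat_testBit]

/-- The divisibility `2 ^ i ∣ x + 1` says that the digits of `x` below `i` are all `1`, so that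
adding `1` sends a carry into digit `i`. -/
theorem bits_succ (x i : ℕ) :
    bits (x + 1) i = if 2 ^ i ∣ x + 1 then 1 - bits x i else bits x i := by
  rw [bits_eq, bits_eq, Nat.succ_div]
  split <;> omega

/-- A carry leaves digit `i` iff it arrives there and finds a `1`. This maintains the carry register
in `increment`. -/
theorem two_pow_succ_dvd_succ (x i : ℕ) :
    2 ^ (i + 1) ∣ x + 1 ↔ 2 ^ i ∣ x + 1 ∧ bits x i ≠ 0 := by
  have h : 2 ^ (i + 1) ∣ x + 1 → 2 ^ i ∣ x + 1 := (pow_dvd_pow 2 (Nat.le_succ i)).trans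
  by_cases hd : 2 ^ i ∣ x + 1
  · simp only [hd, true_and]
    have hq : (x + 1) / 2 ^ i = _ := Nat.succ_div
    rw [if_pos hd] at hq
    obtain ⟨q, hq'⟩ := hd
    rw [hq', Nat.mul_div_cancel_left _ (by positivity)] at hq
    rw [hq', pow_succ, Nat.mul_dvd_mul_iff_left (by positivity), bits_eq]
    omega
  · exact ⟨fun h' => absurd (h h') hd, fun h' => absurd h'.1 hd⟩

/-- One round of the transform: rotate the digits of the index by one place, and let the digit
moved from the top to the bottom be decreased at will. -/
def shuffled (h : ℕ) (f : ℕ → ℕ) (x : ℕ) : ℕ :=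
  if x % 2 = 0 ∨ f (x / 2) ≠ 0 then f (x / 2) else f (x / 2 + h)

theorem bits_half (x i : ℕ) : bits (x / 2) i = bits x (i + 1) := by
  simp only [bits_eq, pow_succ', Nat.div_div_eq_div_mul]

theorem bits_add_two_pow {x n i : ℕ} (hx : x < 2 ^ n) (hi : i ≤ n) :
    bits (x + 2 ^ n) i = if i = n then 1 else bits x i := by
  split_ifs with h
  · rw [bits_eq, h, Nat.add_div_right _ (by positivity), Nat.div_eq_of_lt hx]
  · rw [bits_eq, bits_eq, show n = i + (n - i - 1 + 1) by omega, pow_add,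
      Nat.add_mul_div_left _ _ (by positivity), pow_succ]
    omega

theorem bits_of_lt {x n : ℕ} (hx : x < 2 ^ n) : bits x n = 0 := by
  rw [bits_eq, Nat.div_eq_of_lt hx]

theorem bits_le_one (x i : ℕ) : bits x i ≤ 1 := by
  rw [bits_eq]; omega

theorem eq_of_bits {x y n : ℕ} (hx : x < 2 ^ n) (hy : y < 2 ^ n)
    (h : ∀ i < n, bits x i = bits y i) : x = y := by
  refine Nat.eq_of_testBit_eq fun i => ?_
  rcases Nat.lt_or_ge i n with hi | hi
  · have := h i hi
    unfold bits at this
    revert this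
    cases x.testBit i <;> cases y.testBit i <;> simp
  · have h2 : 2 ^ n ≤ 2 ^ i := Nat.pow_le_pow_right (by omega) hi
    rw [Nat.testBit_lt_two_pow (hx.trans_le h2), Nat.testBit_lt_two_pow (hy.trans_le h2)]

/-- After `t` rounds the low `t` digits of the index are the original top `t` digits, already
allowed to decrease, while the others have moved up by `t` places unchanged. At `t = n + 1` the
rotation is complete and `y` ranges over the subsets of `x`. -/
theorem shuffled_iterate {n t : ℕ} (f : ℕ → ℕ) (ht : t ≤ n + 1) {x : ℕ} (hx : x < 2 ^ (n + 1)) :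
    (shuffled (2 ^ n))^[t] f x ≠ 0 ↔ ∃ y < 2 ^ (n + 1),
      (∀ j < n + 1 - t, bits y j = bits x (j + t)) ∧
      (∀ j < t, bits y (j + (n + 1 - t)) ≤ bits x j) ∧ f y ≠ 0 := by
  induction t generalizing x with
  | zero =>
    simp only [Function.iterate_zero, id]
    refine ⟨fun h => ⟨x, hx, by simp, by simp, h⟩, fun ⟨y, hy, h, _, h'⟩ => ?_⟩
    rwa [eq_of_bits hx hy fun i hi => (h i (by omega)).symm]
  | succ t ih =>
    rw [Function.iterate_succ', Function.comp]
    have hx2 : x / 2 < 2 ^ n := by rw [pow_succ] at hx; omega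
    have hpow : 2 ^ (n + 1) = 2 ^ n + 2 ^ n := by ring
    have ih1 := ih (by omega) (x := x / 2) (by omega)
    have ih2 := ih (by omega) (x := x / 2 + 2 ^ n) (by omega)
    have hx0 : bits x 0 = x % 2 := by simp [bits_eq]
    -- The new bottom digit of `x` is the old top digit: value `0` admits only the lower half of the
    -- table, value `1` admits both halves.
    have step : shuffled (2 ^ n) ((shuffled (2 ^ n))^[t] f) x ≠ 0 ↔
        (shuffled (2 ^ n))^[t] f (x / 2) ≠ 0 ∨
          (bits x 0 = 1 ∧ (shuffled (2 ^ n))^[t] f (x / 2 + 2 ^ n) ≠ 0) := by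
      have : x % 2 = 0 ∨ x % 2 = 1 := by omega
      rw [hx0]
      by_cases h0 : (shuffled (2 ^ n))^[t] f (x / 2) = 0 <;> rcases this with h | h <;>
        simp [shuffled, h0, h]
    rw [step, ih1, ih2]
    constructor
    · rintro (⟨y, hy, h1, h2, h3⟩ | ⟨h0, y, hy, h1, h2, h3⟩)
      · refine ⟨y, hy, fun j hj => ?_, fun j hj => ?_, h3⟩
        · rw [h1 j (by omega), bits_half, add_assoc]
        · rcases j with _ | j
          · rw [h1 _ (by omega), show 0 + (n + 1 - (t + 1)) + t = n by omega, bits_of_lt hx2]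
            omega
          · have := h2 j (by omega)
            rwa [bits_half, show j + (n + 1 - t) = j + 1 + (n + 1 - (t + 1)) by omega] at this
      · refine ⟨y, hy, fun j hj => ?_, fun j hj => ?_, h3⟩
        · rw [h1 j (by omega), bits_add_two_pow hx2 (by omega), if_neg (by omega), bits_half,
            add_assoc]
        · rcases j with _ | j
          · rw [h0]; exact bits_le_one _ _
          · have := h2 j (by omega)
            rwa [bits_add_two_pow hx2 (by omega), if_neg (by omega), bits_half,
              show j + (n + 1 - t) = j + 1 + (n + 1 - (t + 1)) by omega] at this
    · rintro ⟨y, hy, h1, h2, h3⟩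
      have hlow : ∀ j < n + 1 - (t + 1), bits y j = bits (x / 2) (j + t) := fun j hj => by
        rw [h1 j hj, bits_half, add_assoc]
      have htop := h2 0 (by omega)
      rw [zero_add] at htop
      have hrest : ∀ j < t, bits y (j + (n + 1 - t)) ≤ bits (x / 2) j := fun j hj => by
        have := h2 (j + 1) (by omega)
        rwa [bits_half, show j + (n + 1 - t) = j + 1 + (n + 1 - (t + 1)) by omega]
      -- This digit of `y` must equal the top digit of the index one round earlier, so it determines
      -- the half of the table from which `y` comes.
      by_cases hb : bits y (n + 1 - (t + 1)) = 0
      · refine .inl ⟨y, hy, fun j hj => ?_, hrest, h3⟩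
        rcases Nat.lt_or_ge j (n + 1 - (t + 1)) with h | h
        · exact hlow j h
        · obtain rfl : j = n + 1 - (t + 1) := by omega
          rw [hb, show n + 1 - (t + 1) + t = n by omega, bits_of_lt hx2]
      · have hb1 := bits_le_one y (n + 1 - (t + 1))
        have hx1 := bits_le_one x 0
        refine .inr ⟨by omega, y, hy, fun j hj => ?_, fun j hj => ?_, h3⟩
        · rw [bits_add_two_pow hx2 (by omega)]
          rcases Nat.lt_or_ge j (n + 1 - (t + 1)) with h | h
          · rw [if_neg (by omega), hlow j h]
          · obtain rfl : j = n + 1 - (t + 1) := by omega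
            rw [if_pos (by omega)]
            omega
        · rw [bits_add_two_pow hx2 (by omega), if_neg (by omega)]
          exact hrest j hj

theorem shuffled_iterate_self {n : ℕ} (f : ℕ → ℕ) {x : ℕ} (hx : x < 2 ^ (n + 1)) :
    (shuffled (2 ^ n))^[n + 1] f x ≠ 0 ↔
      ∃ y < 2 ^ (n + 1), (∀ i < n + 1, bits y i ≤ bits x i) ∧ f y ≠ 0 := by
  rw [shuffled_iterate f le_rfl hx]
  simp

/-- Both entries that are read lie in the table again, so the contents of the array beyond it never
matter. -/
theorem shuffled_congr {h : ℕ} {f g : ℕ → ℕ} (hfg : ∀ x < 2 * h, f x = g x) {x : ℕ}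
    (hx : x < 2 * h) : shuffled h f x = shuffled h g x := by
  rw [shuffled, shuffled, hfg _ (by omega), hfg _ (by omega)]

/-! ### Programs that tabulate and search all sets of voters -/

namespace Table

variable {D : Table} {N : ℕ}

/-- Pass from the digits of `x` in array `1` to those of `x + 1`. -/
def increment : Program :=
  .instr (.const 19 1) ;; forLoop 7 1 (.ite (.eq 19 14) .skip (.instr (.load 13 1 7) ;;
    .ite (.eq 13 14) (.instr (.inc 13) ;; .instr (.store 1 7 13) ;; .instr (.copy 19 14))
      (.instr (.store 1 7 14))))

theorem increment_spec {s : State} {x : ℕ} (hD : D.Bounded N) (he : D.Env s)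
    (hx : ∀ i < D.n, s.mem 1 i = bits x i) :
    Tri increment s (11 * N) (fun s' => ∀ i < D.n, s'.mem 1 i = bits (x + 1) i) := by
  have e₀ : D.Env ((Instr.const 19 1).exec s) := he.instr (by decide)
  refine (Tri.cons (i := .const 19 1) (T := D.n * (6 + 2) + 2)
    (((Tri.forLoop (T := 6) (fun i s' =>
      -- Register `19` is the carry into digit `i`; the digits below `i` are already those of `x +
      -- 1`.
      (s'.reg 19 = if 2 ^ i ∣ x + 1 then 1 else 0) ∧
      ∀ j < D.n, s'.mem 1 j = bits (if j < i then x + 1 else x) j) e₀.n rfl rfl ?_ ?_)).mono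
      le_rfl ?_)).time ?_
  · simpa [Instr.exec] using hx
  · intro i s₁ hi hix a₁ ⟨h19, h₁⟩
    have e₁ := e₀.agree a₁ (by decide)
    have hbi := h₁ i hi
    rw [if_neg (lt_irrefl i)] at hbi
    have hsucc := bits_succ x i
    have hdvd := two_pow_succ_dvd_succ x i
    have hle := bits_le_one x i
    have hj : ∀ j, bits (if j < i + 1 then x + 1 else x) j =
        if j = i then bits (x + 1) i else bits (if j < i then x + 1 else x) j := by
      intro j
      rcases lt_trichotomy j i with h | rfl | h
      · simp [h, h.ne, h.trans (Nat.lt_succ_self i)]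
      · simp
      · simp [h.ne', h.not_gt, show ¬ j < i + 1 by omega]
    refine Tri.ite ?_ ?_
    · intro hb
      have hnd : ¬ 2 ^ i ∣ x + 1 := by simpa [Test.Holds, h19, e₁.zero] using hb
      refine Tri.skip ⟨by simp [h19, hdvd, hnd], fun j hjn => ?_⟩
      rw [if_neg hnd] at hsucc
      rw [State.setReg_mem, hj, h₁ j hjn]
      split_ifs with h h' <;> simp_all
    · intro hb
      have hd : 2 ^ i ∣ x + 1 := by simpa [Test.Holds, h19, e₁.zero] using hb
      rw [if_pos hd] at hsucc h19
      refine Tri.cons (T := 4) (Tri.ite (T := 3) ?_ ?_)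
      · intro hb
        have hb : bits x i = 0 := by simpa [Test.Holds, Instr.exec, e₁.zero, hix, hbi] using hb
        refine Tri.cons (Tri.cons (Tri.instr ⟨?_, fun j hjn => ?_⟩))
        · simp [Instr.exec, e₁.zero, hdvd, hb]
        · rw [hj]
          simp [Instr.exec, hix, hbi, hb, hsucc, h₁ j hjn]
      · intro hb
        have hb : bits x i ≠ 0 := by simpa [Test.Holds, Instr.exec, e₁.zero, hix, hbi] using hb
        refine Tri.instr ⟨?_, fun j hjn => ?_⟩
        · simp [Instr.exec, hdvd, hb, h19, hd]
        · rw [hj, hsucc, show 1 - bits x i = 0 by omega]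
          simp [Instr.exec, hix, h₁ j hjn, e₁.zero]
  · intro s' _ h i hi
    rw [h.2 i hi, if_pos hi]
  · have := hD.n
    have := hD.one
    omega

/-- Fill arrays `2` and `3` with the defects and the slacks of all sets of voters. -/
def fillTable : Program :=
  forLoop 21 20 (countDefect ;; .instr (.store 2 21 15) ;; .instr (.store 3 21 16) ;; increment)

/-- Array `1` acts as a binary counter alongside register `21`. The zero array represents the empty
set, and passing to the next set costs only `O(N)` steps. -/
theorem fillTable_spec {s : State} (hD : D.Bounded N) (he : D.Env s) (h6 : s.reg 6 ≤ N)
    (hz : ∀ i, s.mem 1 i = 0) :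
    Tri fillTable s (s.reg 20 * (95 * N ^ 4) + 2) (fun s' => ∀ x < s.reg 20,
      s'.mem 2 x = D.defect (s.reg 6) (bits x) ∧ s'.mem 3 x = D.slack (bits x)) := by
  have hN : N ≤ N ^ 4 := Nat.le_self_pow (by omega) N
  have h1 := hD.one
  refine ((Tri.forLoop (T := 80 * N ^ 4 + (11 * N + 1 + 1)) (fun x s' =>
    (∀ i < D.n, s'.mem 1 i = bits x i) ∧ ∀ y < x, s'.mem 2 y = D.defect (s.reg 6) (bits y) ∧
      s'.mem 3 y = D.slack (bits y)) rfl rfl rfl ?_ ?_)).mono ?_ ?_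
  · simp [bits_eq, hz]
  · intro x s₁ hx hix a₁ ⟨hb, ht⟩
    have e₁ := he.agree a₁ (by decide)
    have r₁ : s₁.reg 6 = s.reg 6 := a₁.reg 6 rfl
    refine Tri.seq (countDefect_spec hD e₁ (by omega)) ?_
    intro s₂ a₂ ⟨h15, h16⟩
    have e₂ := e₁.agree a₂ (by decide)
    rw [D.defect_congr hb, r₁] at h15
    rw [D.slack_congr hb] at h16
    have r21 : s₂.reg 21 = x := by rw [a₂.reg 21 rfl, hix]
    refine Tri.cons (Tri.cons ?_)
    refine (increment_spec (x := x) hD ((e₂.instr (i := .store 2 21 15) (by decide)).instr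
      (i := .store 3 21 16) (by decide)) ?_).mono le_rfl ?_
    · simpa [Instr.exec, a₂.mem 1 rfl] using hb
    · intro s₃ a₃ h₃
      refine ⟨h₃, fun y hy => ?_⟩
      rw [State.setReg_mem, a₃.mem 2 rfl, a₃.mem 3 rfl]
      simp only [Instr.exec, State.setMem_mem, State.setMem_reg, r21, h15, h16, a₂.mem 2 rfl,
        a₂.mem 3 rfl]
      rcases Nat.lt_or_ge y x with h | h
      · simpa [h.ne] using ht y h
      · obtain rfl : y = x := by omega
        simp
  · gcongr
    omega
  · exact fun s' _ h => h.2

/-- `reg 20 := 2 ^ n` and `reg 24 := 2 ^ (n - 1)`. -/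
def power : Program :=
  .instr (.const 20 1) ;; forLoop 7 1 (.instr (.copy 24 20) ;; addReg 11 20 24)

theorem power_spec {s : State} {n : ℕ} (he : D.Env s) (hn : D.n = n + 1) (hN : D.n ≤ N) :
    Tri power s (8 * N * 2 ^ D.n) (fun s' => s'.reg 20 = 2 ^ D.n ∧ s'.reg 24 = 2 ^ n) := by
  have e₀ : D.Env ((Instr.const 20 1).exec s) := he.instr (by decide)
  refine (Tri.cons (i := .const 20 1) (T := D.n * ((3 * 2 ^ n + 2 + 1) + 2) + 2)
    (((Tri.forLoop (T := 3 * 2 ^ n + 2 + 1) (fun i s' => s'.reg 20 = 2 ^ i ∧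
      -- Register `24` lags one doubling behind register `20`, so it has no prescribed value before
      -- the first round.
      (i ≠ 0 → 2 * s'.reg 24 = 2 ^ i)) e₀.n rfl rfl ?_ ?_)).mono le_rfl ?_)).time ?_
  · simp [Instr.exec]
  · intro i s₁ hi _ _ ⟨h20, _⟩
    have hp : 2 ^ i ≤ 2 ^ n := Nat.pow_le_pow_right (by omega) (by omega)
    refine Tri.cons ?_
    refine (addReg_spec (by decide) (by decide) (by decide)
      (by simp [Instr.exec, h20, hp])).mono le_rfl ?_
    intro s₂ a₂ h₂
    simp only [State.setReg_reg, h₂, a₂.reg 24 rfl]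
    simp [Instr.exec, h20, pow_succ']
    omega
  · intro s' _ ⟨h, h'⟩
    refine ⟨h, ?_⟩
    have := h' (by omega)
    rw [hn, pow_succ'] at this
    omega
  · have h1 : 1 ≤ 2 ^ n := Nat.one_le_two_pow
    rw [hn] at hN ⊢
    rw [pow_succ']
    nlinarith

/-- One round of the transform of array `2`. -/
def shuffle : Program :=
  .instr (.copy 25 24) ;; .instr (.const 26 0) ;;
  forLoop 23 24 (.instr (.load 27 2 23) ;; .instr (.load 28 2 25) ;; .instr (.store 4 26 27) ;;
    .instr (.inc 26) ;; .ite (.eq 27 14) (.instr (.copy 27 28)) .skip ;;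
    .instr (.store 4 26 27) ;; .instr (.inc 26) ;; .instr (.inc 25)) ;;
  forLoop 23 20 (.instr (.load 27 4 23) ;; .instr (.store 2 23 27))

/-- Registers `23` and `25` run through the two halves of array `2`, and register `26` through the
interleaved output in array `4`: the entry `2 * j` copies entry `j`, and the entry `2 * j + 1`
combines entries `j` and `h + j`. The result is then copied back. -/
theorem shuffle_spec {s : State} {h : ℕ} (he : D.Env s) (h24 : s.reg 24 = h)
    (h20 : s.reg 20 = 2 * h) :
    Tri shuffle s (20 * h + 6) (fun s' => ∀ x < 2 * h, s'.mem 2 x = shuffled h (s.mem 2) x) := by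
  refine (Tri.cons (Tri.cons (Tri.seq (T := h * (9 + 2) + 2) (T' := 2 * h * (2 + 2) + 2)
    (Q := fun s' => ∀ x < 2 * h, s'.mem 4 x = shuffled h (s.mem 2) x) ?_ ?_))).time (by omega)
  · refine (Tri.forLoop (T := 9) (fun j s' => s'.reg 25 = h + j ∧ s'.reg 26 = 2 * j ∧
      ∀ x < 2 * j, s'.mem 4 x = shuffled h (s.mem 2) x) ?_ rfl rfl ?_ ?_).mono le_rfl ?_
    · simp [Instr.exec, h24]
    · simp [Instr.exec, h24]
    · intro j s₁ hj hix a₁ ⟨h25, h26, h4⟩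
      have m₁ : s₁.mem 2 = s.mem 2 := a₁.mem 2 rfl
      have z₁ : s₁.reg 14 = 0 := by rw [a₁.reg 14 rfl]; simpa [Instr.exec] using he.zero
      refine Tri.cons (Tri.cons (Tri.cons (Tri.cons (T := 5) ?_)))
      set s₂ := (Instr.inc 26).exec ((Instr.store 4 26 27).exec ((Instr.load 28 2 25).exec
        ((Instr.load 27 2 23).exec s₁))) with hs₂
      have k25 : s₂.reg 25 = h + j := by simp [hs₂, Instr.exec, h25]
      have k26 : s₂.reg 26 = 2 * j + 1 := by simp [hs₂, Instr.exec, h26]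
      have k27 : s₂.reg 27 = s.mem 2 j := by simp [hs₂, Instr.exec, hix, m₁]
      have k28 : s₂.reg 28 = s.mem 2 (h + j) := by simp [hs₂, Instr.exec, h25, m₁]
      have k14 : s₂.reg 14 = 0 := by simp [hs₂, Instr.exec, z₁]
      have k4 : ∀ x, s₂.mem 4 x = if x = 2 * j then s.mem 2 j else s₁.mem 4 x := by
        intro x; simp [hs₂, Instr.exec, hix, h26, m₁]
      clear_value s₂
      refine Tri.seq (T := 2) (T' := 3) (Q := fun s' =>
        s'.reg 27 = if s.mem 2 j = 0 then s.mem 2 (h + j) else s.mem 2 j) ?_ ?_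
      · refine Tri.ite ?_ ?_
        · intro hb
          refine Tri.instr ?_
          simp [Test.Holds, k27, k14] at hb
          simp [Instr.exec, k28, hb]
        · intro hb
          refine Tri.skip ?_
          simp [Test.Holds, k27, k14] at hb
          simp [k27, hb]
      · intro s₃ a₃ h₃
        have l26 := (a₃.reg 26 rfl).trans k26
        have l25 := (a₃.reg 25 rfl).trans k25
        have l4 := a₃.mem 4 rfl
        refine Tri.cons (Tri.cons (Tri.instr ⟨?_, ?_, fun x hx => ?_⟩))
        · simp [Instr.exec, l25, add_assoc]
        · simp [Instr.exec, l26]; ring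
        · simp [Instr.exec, l26, l4, k4, h₃]
          rcases Nat.lt_or_ge x (2 * j) with hlt | hge
          · rw [if_neg (by omega), if_neg (by omega), h4 x hlt]
          · obtain rfl | rfl : x = 2 * j ∨ x = 2 * j + 1 := by omega
            · simp [shuffled]
            · rw [if_pos rfl, shuffled, show (2 * j + 1) / 2 = j by omega,
                show (2 * j + 1) % 2 = 1 by omega]
              by_cases h0 : s.mem 2 j = 0 <;> simp [h0, add_comm]
    · exact fun s' _ hs => hs.2.2
  · intro s₁ a₁ h₁
    have r20 : s₁.reg 20 = 2 * h := by rw [a₁.reg 20 rfl]; simpa [Instr.exec] using h20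
    refine (Tri.forLoop (T := 2) (fun j s' => ∀ x < j, s'.mem 2 x = shuffled h (s.mem 2) x) r20
      rfl rfl (by simp) ?_)
    intro j s₂ hj hix a₂ h₂
    refine Tri.cons (Tri.instr fun x hx => ?_)
    have m4 : s₂.mem 4 = s₁.mem 4 := a₂.mem 4 rfl
    simp [Instr.exec, hix, m4]
    split_ifs with hxj
    · rw [hxj, h₁ j hj]
    · exact h₂ x (by omega)

/-- Mark in array `2` all sets with a marked subset. -/
def closure : Program := forLoop 22 1 shuffle

theorem closure_spec {s : State} {n : ℕ} (hD : D.Bounded N) (he : D.Env s) (hn : D.n = n + 1)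
    (h24 : s.reg 24 = 2 ^ n) (h20 : s.reg 20 = 2 ^ (n + 1)) :
    Tri closure s (20 * N * 2 ^ D.n) (fun s' => ∀ x < 2 ^ D.n, (s'.mem 2 x ≠ 0 ↔
      ∃ y < 2 ^ D.n, (∀ i < D.n, bits y i ≤ bits x i) ∧ s.mem 2 y ≠ 0)) := by
  refine (Tri.forLoop (T := 20 * 2 ^ n + 6) (fun t s' => ∀ x < 2 * 2 ^ n,
    s'.mem 2 x = (shuffled (2 ^ n))^[t] (s.mem 2) x) he.n rfl rfl ?_ ?_).mono ?_ ?_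
  · simp
  · intro t s₁ ht _ a₁ h₁
    have e₁ := he.agree a₁ (by decide)
    refine (shuffle_spec e₁ (by rw [a₁.reg 24 rfl, h24])
      (by rw [a₁.reg 20 rfl, h20, pow_succ'])).mono le_rfl ?_
    intro s₂ _ h₂ x hx
    rw [Function.iterate_succ', Function.comp, State.setReg_mem, h₂ x hx]
    exact shuffled_congr h₁ hx
  · have h1 : 1 ≤ 2 ^ n := Nat.one_le_two_pow
    have := hD.n
    rw [hn] at this ⊢
    rw [pow_succ']
    nlinarith
  · intro s' _ h x hx
    rw [hn] at hx ⊢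
    rw [h x (by rwa [← pow_succ']), hn]
    exact shuffled_iterate_self _ hx

/-- Look for a set that is not marked in array `2` and has no slack. -/
def search : Program :=
  forLoop 23 20 (.instr (.load 27 2 23) ;; .instr (.load 28 3 23) ;;
    .ite (.eq 27 14) (.ite (.eq 28 14) (.instr (.const 0 1)) .skip) .skip)

open Classical in
theorem search_spec {s : State} (he : D.Env s) (h0 : s.reg 0 = 0) :
    Tri search s (s.reg 20 * 7 + 2) (fun s' => s'.reg 0 =
      if ∃ x < s.reg 20, s.mem 2 x = 0 ∧ s.mem 3 x = 0 then 1 else 0) := by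
  refine Tri.forLoop (T := 5) (fun j s' => s'.reg 0 =
      if ∃ x < j, s.mem 2 x = 0 ∧ s.mem 3 x = 0 then 1 else 0) rfl rfl rfl ?_ ?_
  · simp [h0]
  · intro j s₁ hj hix a₁ h₁
    have e₁ := he.agree a₁ (by decide)
    have m2 : s₁.mem 2 = s.mem 2 := a₁.mem 2 rfl
    have m3 : s₁.mem 3 = s.mem 3 := a₁.mem 3 rfl
    have hex : (∃ x < j + 1, s.mem 2 x = 0 ∧ s.mem 3 x = 0) ↔
        (s.mem 2 j = 0 ∧ s.mem 3 j = 0) ∨ ∃ x < j, s.mem 2 x = 0 ∧ s.mem 3 x = 0 :=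
      Nat.exists_lt_succ_right.trans or_comm
    simp only [hex]
    refine Tri.cons (Tri.cons (Tri.ite (T := 2) ?_ ?_))
    · intro hb
      simp [Test.Holds, Instr.exec, hix, m2, e₁.zero] at hb
      refine Tri.ite ?_ ?_
      · intro hb'
        simp [Test.Holds, Instr.exec, hix, m3, e₁.zero] at hb'
        refine Tri.instr ?_
        simp [Instr.exec, hb, hb']
      · intro hb'
        simp [Test.Holds, Instr.exec, hix, m3, e₁.zero] at hb'
        refine Tri.skip ?_
        simp [Instr.exec, hb', h₁]
    · intro hb
      simp [Test.Holds, Instr.exec, hix, m2, e₁.zero] at hb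
      refine Tri.skip ?_
      simp [Instr.exec, hb, h₁]

/-- The set of voters with index `x` can be bribed, with `u` approvals allowed to remain for each
distinguished candidate. -/
def Good (D : Table) (u x : ℕ) : Prop :=
  D.slack (bits x) = 0 ∧
    ∀ y < 2 ^ D.n, (∀ i < D.n, bits y i ≤ bits x i) → D.defect u (bits y) = 0

/-- The main part of the procedure, after the input has been read. -/
def solve : Program :=
  threshold ;; .ite (.eq 6 14) .skip
    (.instr (.dec 6) ;; power ;; fillTable ;; closure ;; search)

open Classical in
theorem solve_spec {s : State} (hD : D.Bounded N) (he : D.Env s) (hn : 1 ≤ D.n)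
    (h0 : s.reg 0 = 0) (hz : ∀ i, s.mem 1 i = 0) :
    Tri solve s (2 ^ D.n * (300 * N ^ 5)) (fun s' => ∃ T, D.IsThreshold T ∧
      s'.reg 0 = if T ≠ 0 ∧ ∃ x < 2 ^ D.n, D.Good (T - 1) x then 1 else 0) := by
  -- The table has two halves of size `2 ^ (D.n - 1)`, which requires a voter.
  obtain ⟨n, hn⟩ : ∃ n, D.n = n + 1 := ⟨D.n - 1, by omega⟩
  have hN : 1 ≤ N ^ 5 := Nat.one_le_pow _ _ hD.one
  have hN1 : N ≤ N ^ 5 := Nat.le_self_pow (by omega) N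
  have hN4 : N ^ 4 ≤ N ^ 5 := Nat.pow_le_pow_right hD.one (by omega)
  have hK : 1 ≤ 2 ^ D.n := Nat.one_le_two_pow
  refine (Tri.seq (T' := (8 * N * 2 ^ D.n + ((2 ^ D.n * (95 * N ^ 4) + 2) +
    (20 * N * 2 ^ D.n + (2 ^ D.n * 7 + 2)))) + 1 + 1) (threshold_spec hD he hz) ?_).time ?_
  · intro s₁ a₁ h₁
    have e₁ := he.agree a₁ (by decide)
    refine Tri.ite ?_ ?_
    · intro hb
      simp only [Test.Holds, e₁.zero] at hb
      refine Tri.skip ⟨_, h₁, ?_⟩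
      rw [hb, a₁.reg 0 rfl, h0]
      simp
    · intro hb
      simp only [Test.Holds, e₁.zero] at hb
      refine Tri.cons ?_
      have e₂ : D.Env ((Instr.dec 6).exec s₁) := e₁.instr (by decide)
      refine Tri.seq (power_spec e₂ hn hD.n) ?_
      intro s₃ a₃ ⟨h20, h24⟩
      have e₃ := e₂.agree a₃ (by decide)
      have h6 : s₃.reg 6 = s₁.reg 6 - 1 := by rw [a₃.reg 6 rfl]; simp [Instr.exec]
      have hz₃ : ∀ i, s₃.mem 1 i = 0 := by
        rw [a₃.mem 1 rfl]
        simpa [Instr.exec, a₁.mem 1 rfl] using hz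
      have hle := h₁.1.trans hD.n
      rw [← h20]
      refine Tri.seq (fillTable_spec hD e₃ (by omega) hz₃) ?_
      intro s₄ a₄ h₄
      have e₄ := e₃.agree a₄ (by decide)
      rw [h20, h6] at h₄
      have k20 : s₄.reg 20 = 2 ^ D.n := by rw [a₄.reg 20 rfl, h20]
      rw [h20]
      refine Tri.seq (closure_spec hD e₄ hn (by rw [a₄.reg 24 rfl, h24]) (by rw [k20, hn])) ?_
      intro s₅ a₅ h₅
      have e₅ := e₄.agree a₅ (by decide)
      have l20 : s₅.reg 20 = 2 ^ D.n := by rw [a₅.reg 20 rfl, k20]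
      rw [← l20]
      refine (search_spec e₅ ?_).mono le_rfl ?_
      · rw [a₅.reg 0 rfl, a₄.reg 0 rfl, a₃.reg 0 rfl]
        simp [Instr.exec, a₁.reg 0 rfl, h0]
      · intro s₆ _ h₆
        refine ⟨_, h₁, h₆.trans ?_⟩
        congr 1
        simp only [ne_eq, hb, not_false_eq_true, true_and, l20, eq_iff_iff]
        refine exists_congr fun x => and_congr_right fun hx => ?_
        rw [Good, and_comm, a₅.mem 3 rfl, (h₄ x hx).2]
        refine and_congr_right fun _ => ?_
        -- A set stays unmarked after the closure iff all its subsets have defect `0`.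
        rw [← not_iff_not, ← ne_eq, h₅ x hx]
        push Not
        refine exists_congr fun y => and_congr_right fun hy => and_congr_right fun _ => ?_
        rw [(h₄ y hy).1]
  · have a1 : N * 2 ^ D.n ≤ 2 ^ D.n * N ^ 5 := by rw [mul_comm]; gcongr
    have a2 : 2 ^ D.n * N ^ 4 ≤ 2 ^ D.n * N ^ 5 := by gcongr
    have a3 : 2 ^ D.n ≤ 2 ^ D.n * N ^ 5 := Nat.le_mul_of_pos_right _ hN
    have a4 : N ^ 5 ≤ 2 ^ D.n * N ^ 5 := Nat.le_mul_of_pos_left _ hK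
    linarith

end Table
end ApprovalBribery

/-! ### The combinatorial characterization of yes-instances -/

namespace ApprovalBribery

section Combinatorics

variable {C ι : Type} [DecidableEq C] [Fintype ι]

theorem exists_isWinningCommittee [Fintype C] (V : ι → Finset C) {k : ℕ}
    (hk : k ≤ Fintype.card C) : ∃ w, IsWinningCommittee V k w := by
  have hne : (Finset.powersetCard k (Finset.univ : Finset C)).Nonempty :=
    Finset.powersetCard_nonempty.2 (by simpa using hk)
  obtain ⟨w, hw, hmax⟩ := Finset.exists_max_image _ (avScore V) hne
  refine ⟨w, (Finset.mem_powersetCard.1 hw).2, fun w' hw' => hmax w' ?_⟩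
  exact Finset.mem_powersetCard.2 ⟨Finset.subset_univ _, hw'⟩

variable [DecidableEq ι]

/-- The number of voters outside `B` that approve `c`. -/
def approvals (V : ι → Finset C) (B : Finset ι) (c : C) : ℕ :=
  (Finset.univ.filter fun i => i ∉ B ∧ c ∈ V i).card

theorem avScore_eq_sum (V : ι → Finset C) (w : Finset C) :
    avScore V w = ∑ c ∈ w, approvals V ∅ c := by
  have h : ∀ i, (V i ∩ w).card = ∑ c ∈ w, if c ∈ V i then 1 else 0 := fun i => by
    rw [Finset.inter_comm, ← Finset.filter_mem_eq_inter, Finset.card_filter]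
  simp only [avScore, h, approvals, Finset.notMem_empty, not_false_eq_true, true_and,
    Finset.card_filter]
  exact Finset.sum_comm

/-- The exchange is stated additively to avoid subtraction of natural numbers. -/
theorem avScore_swap (V : ι → Finset C) {w : Finset C} {c d : C} (hc : c ∉ w) (hd : d ∈ w) :
    (insert c (w.erase d)).card = w.card ∧
      avScore V (insert c (w.erase d)) + approvals V ∅ d = avScore V w + approvals V ∅ c := by
  have hc' : c ∉ w.erase d := fun h => hc (Finset.mem_of_mem_erase h)
  constructor
  · rw [Finset.card_insert_of_notMem hc', Finset.card_erase_add_one hd]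
  · rw [avScore_eq_sum, avScore_eq_sum, Finset.sum_insert hc', ← Finset.add_sum_erase w _ hd]
    ring

/-- No member of `J` is in a winning `k`-committee iff `k` candidates beat all members of `J`. -/
theorem forall_isWinningCommittee_iff [Fintype C] (V : ι → Finset C) {k : ℕ}
    (hk : k ≤ Fintype.card C) (J : Finset C) :
    (∀ w, IsWinningCommittee V k w → ∀ c ∈ J, c ∉ w) ↔
      ∃ W : Finset C, W.card = k ∧ ∀ c ∈ J, ∀ d ∈ W, approvals V ∅ c < approvals V ∅ d := by
  constructor
  · intro h
    obtain ⟨w, hw⟩ := exists_isWinningCommittee V hk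
    refine ⟨w, hw.1, fun c hc d hd => ?_⟩
    obtain ⟨h1, h2⟩ := avScore_swap V (h w hw c hc) hd
    have hle := hw.2 _ (h1.trans hw.1)
    -- If `c` had at least as many approvals as `d`, the exchanged committee would also be winning,
    -- and it contains `c`.
    by_contra hlt
    refine h (insert c (w.erase d)) ⟨h1.trans hw.1, fun w' hw' => ?_⟩ c hc
      (Finset.mem_insert_self _ _)
    have := hw.2 w' hw'
    omega
  · rintro ⟨W, hW, hlt⟩ w hw c hc hcw
    have hcW : c ∉ W := fun h => lt_irrefl _ (hlt c hc c h)
    -- As `w` and `W` have equal size and `c` is only in `w`, some `d` is only in `W`; exchanging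
    -- `c` for `d` strictly raises the score of `w`.
    obtain ⟨d, hd, hdw⟩ : ∃ d ∈ W, d ∉ w := by
      by_contra! hsub
      exact hcW ((Finset.eq_of_subset_of_card_le hsub (by rw [hW, hw.1])) ▸ hcw)
    obtain ⟨h1, h2⟩ := avScore_swap V hdw hcw
    have := hw.2 _ (h1.trans hw.1)
    have := hlt c hc d hd
    omega

theorem approvals_sdiff (V : ι → Finset C) {S A : Finset ι} (hA : A ⊆ S) (c : C) :
    approvals V (S \ A) c = approvals V S c + (A.filter fun i => c ∈ V i).card := by
  rw [approvals, approvals, ← Finset.card_union_of_disjoint]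
  · congr 1
    ext i
    have := @hA i
    simp only [Finset.mem_filter, Finset.mem_univ, true_and, Finset.mem_union, Finset.mem_sdiff]
    tauto
  · rw [Finset.disjoint_left]
    intro i hi hi'
    simp only [Finset.mem_filter, Finset.mem_univ, true_and] at hi hi'
    exact hi.1 (hA hi'.1)

/-- A degree-constrained version of Hall's theorem: if the demands can be met in the aggregate by
every set of voters, then approvals can be deleted accordingly. -/
theorem exists_deletion (V : ι → Finset C) (J : Finset C) (S : Finset ι) (r u : ℕ)
    (h : ∀ B ⊆ S, ∑ c ∈ J, (approvals V B c - u) ≤ (S.card - B.card) * r) :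
    ∃ V' : ι → Finset C, (∀ i, V' i ⊆ V i) ∧ (∀ i ∉ S, V' i = V i) ∧
      (∀ i, V i \ V' i ⊆ J) ∧ (∀ i, (V i \ V' i).card ≤ r) ∧ ∀ c ∈ J, approvals V' ∅ c ≤ u := by
  classical
  let E := {e : ι × C // e.1 ∈ S ∧ e.2 ∈ J ∧ e.2 ∈ V e.1}
  -- Each approval `(i, c)` needs a slot of its own: one of the `r` deletion slots of voter `i`, or
  -- one of the slots for approvals that `c` may keep within `S`. Outside `S` candidate `c` has
  -- `approvals V S c` of its `u` permitted approvals.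
  let t : E → Finset ((Σ _ : ι, ℕ) ⊕ (Σ _ : C, ℕ)) := fun e =>
    (({e.1.1} : Finset ι).sigma fun _ => Finset.range r).disjSum
      (({e.1.2} : Finset C).sigma fun c => Finset.range (u - approvals V S c))
  have hall : ∀ F : Finset E, F.card ≤ (F.biUnion t).card := by
    intro F
    set A := F.image fun e => e.1.1
    set K := F.image fun e => e.1.2
    have hA : A ⊆ S := by
      intro i hi
      obtain ⟨e, _, rfl⟩ := Finset.mem_image.1 hi
      exact e.2.1
    have hK : K ⊆ J := by
      intro c hc
      obtain ⟨e, _, rfl⟩ := Finset.mem_image.1 hc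
      exact e.2.2.1
    have h1 : F.card ≤ ∑ c ∈ K, (A.filter fun i => c ∈ V i).card := by
      rw [← Finset.card_sigma]
      refine Finset.card_le_card_of_injOn (fun e => ⟨e.1.2, e.1.1⟩) ?_ ?_
      · intro e he
        simp only [Finset.coe_sigma, Set.mem_sigma_iff, Finset.mem_coe, Finset.mem_filter]
        exact ⟨Finset.mem_image_of_mem _ he, Finset.mem_image_of_mem _ he, e.2.2.2⟩
      · intro e _ e' _ hee
        simp only [Sigma.mk.injEq, heq_eq_eq] at hee
        exact Subtype.ext (Prod.ext hee.2 hee.1)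
    have h2 : (A.sigma fun _ => Finset.range r).disjSum
        (K.sigma fun c => Finset.range (u - approvals V S c)) ⊆ F.biUnion t := by
      intro x hx
      rw [Finset.mem_biUnion]
      rcases x with ⟨i, j⟩ | ⟨c, j⟩
      · simp only [Finset.inl_mem_disjSum, Finset.mem_sigma, A, Finset.mem_image] at hx
        obtain ⟨⟨e, he, rfl⟩, hj⟩ := hx
        exact ⟨e, he, by simpa [t] using hj⟩
      · simp only [Finset.inr_mem_disjSum, Finset.mem_sigma, K, Finset.mem_image] at hx
        obtain ⟨⟨e, he, rfl⟩, hj⟩ := hx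
        exact ⟨e, he, by simpa [t] using hj⟩
    -- Hall's condition for approvals cast by the voters in `A` is the hypothesis for the complement
    -- of `A` in `S`.
    have h3 := h (S \ A) Finset.sdiff_subset
    have h4 : S.card - (S \ A).card = A.card := by
      rw [Finset.card_sdiff_of_subset hA]
      have := Finset.card_le_card hA
      omega
    calc F.card ≤ ∑ c ∈ K, (A.filter fun i => c ∈ V i).card := h1
      _ ≤ ∑ c ∈ K, ((approvals V (S \ A) c - u) + (u - approvals V S c)) := by
          refine Finset.sum_le_sum fun c _ => ?_
          -- The number of voters in `A` approving `c` is at most the excess of `c` without `S \ A`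
          -- plus its spare capacity.
          rw [approvals_sdiff V hA]
          omega
      _ ≤ A.card * r + ∑ c ∈ K, (u - approvals V S c) := by
          rw [Finset.sum_add_distrib, ← h4]
          gcongr
          exact (Finset.sum_le_sum_of_subset hK).trans h3
      _ = ((A.sigma fun _ => Finset.range r).disjSum
            (K.sigma fun c => Finset.range (u - approvals V S c))).card := by
          simp [Finset.card_disjSum, Finset.card_sigma]
      _ ≤ _ := Finset.card_le_card h2
  obtain ⟨f, hf, hft⟩ := (Finset.all_card_le_biUnion_card_iff_exists_injective t).1 hall
  -- The deleted approvals are those matched to a slot of their voter; injectivity bounds both the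
  -- deletions of a voter and the approvals that a candidate keeps.
  let del : ι → C → Prop := fun i c =>
    ∃ (he : i ∈ S ∧ c ∈ J ∧ c ∈ V i) (j : ℕ), f ⟨(i, c), he⟩ = .inl ⟨i, j⟩ ∧ j < r
  refine ⟨fun i => (V i).filter fun c => ¬ del i c, fun i => Finset.filter_subset _ _, ?_, ?_, ?_,
    ?_⟩
  · intro i hi
    exact Finset.filter_true_of_mem fun c _ ⟨he, _⟩ => hi he.1
  · intro i c hc
    simp only [Finset.mem_sdiff, Finset.mem_filter, not_and, not_not] at hc
    exact (hc.2 hc.1).1.2.1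
  · intro i
    refine le_of_le_of_eq ?_ (Finset.card_range r)
    refine Finset.card_le_card_of_forall_subsingleton
      (fun c j => ∃ he : i ∈ S ∧ c ∈ J ∧ c ∈ V i, f ⟨(i, c), he⟩ = .inl ⟨i, j⟩) ?_ ?_
    · intro c hc
      simp only [Finset.mem_sdiff, Finset.mem_filter, not_and, not_not] at hc
      obtain ⟨he, j, hj, hjr⟩ := hc.2 hc.1
      exact ⟨j, Finset.mem_range.2 hjr, he, hj⟩
    · rintro j - c ⟨-, he, hc⟩ c' ⟨-, he', hc'⟩
      exact congrArg (fun e => e.1.2) (hf (hc.trans hc'.symm))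
  · intro c hc
    -- The case `B = S` of the hypothesis: approvals from outside `S` cannot be deleted.
    have hq : approvals V S c ≤ u := by
      have h0 := h S subset_rfl
      rw [Nat.sub_self, Nat.zero_mul] at h0
      have : approvals V S c - u ≤ 0 := (Finset.single_le_sum
        (f := fun c => approvals V S c - u) (fun _ _ => Nat.zero_le _) hc).trans h0
      omega
    set V' : ι → Finset C := fun i => (V i).filter fun c => ¬ del i c with hV'
    have hsplit := approvals_sdiff V' (S := S) subset_rfl c
    rw [Finset.sdiff_self] at hsplit
    have hout : approvals V' S c ≤ approvals V S c := by
      refine Finset.card_le_card fun i => ?_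
      simp only [hV', Finset.mem_filter]
      tauto
    have hin : (S.filter fun i => c ∈ V' i).card ≤ u - approvals V S c := by
      rw [← Finset.card_range (u - approvals V S c)]
      refine Finset.card_le_card_of_forall_subsingleton
        (fun i j => ∃ he : i ∈ S ∧ c ∈ J ∧ c ∈ V i, f ⟨(i, c), he⟩ = .inr ⟨c, j⟩) ?_ ?_
      · intro i hi
        simp only [hV', Finset.mem_filter] at hi
        obtain ⟨hiS, hci, hnd⟩ := hi
        have hmem := hft ⟨(i, c), hiS, hc, hci⟩
        rcases hfe : f ⟨(i, c), hiS, hc, hci⟩ with ⟨i', j⟩ | ⟨c', j⟩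
        · rw [hfe] at hmem
          simp only [t, Finset.inl_mem_disjSum, Finset.mem_sigma, Finset.mem_singleton,
            Finset.mem_range] at hmem
          obtain ⟨rfl, hj⟩ := hmem
          exact absurd ⟨⟨hiS, hc, hci⟩, j, hfe, hj⟩ hnd
        · rw [hfe] at hmem
          simp only [t, Finset.inr_mem_disjSum, Finset.mem_sigma, Finset.mem_singleton] at hmem
          obtain ⟨rfl, hj⟩ := hmem
          exact ⟨j, hj, ⟨hiS, hc, hci⟩, hfe⟩
      · rintro j - i ⟨-, he, hi⟩ i' ⟨-, he', hi'⟩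
        exact congrArg (fun e => e.1.1) (hf (hi.trans hi'.symm))
    omega

theorem approvals_le_add_deleted (V V' : ι → Finset C) (B : Finset ι) (c : C) :
    approvals V B c ≤ approvals V' ∅ c +
      (Finset.univ.filter fun i => i ∉ B ∧ c ∈ V i \ V' i).card := by
  refine le_trans (Finset.card_le_card fun i => ?_) (Finset.card_union_le _ _)
  simp only [Finset.mem_filter, Finset.mem_univ, true_and, Finset.mem_union, Finset.mem_sdiff,
    Finset.notMem_empty, not_false_eq_true]
  tauto

/-- Each `c ∈ J` must lose at least its excess among the voters outside `B`. All these deletions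
occur at voters in `S \ B`, at most `r` at each; double counting gives the bound. -/
theorem sum_approvals_sub_le (V V' : ι → Finset C) (J : Finset C) (S : Finset ι) {r u : ℕ}
    (hS : ∀ i ∉ S, V' i = V i) (hr : ∀ i, (V i \ V' i).card ≤ r)
    (hu : ∀ c ∈ J, approvals V' ∅ c ≤ u) (B : Finset ι) :
    ∑ c ∈ J, (approvals V B c - u) ≤ (S \ B).card * r := by
  calc ∑ c ∈ J, (approvals V B c - u)
      ≤ ∑ c ∈ J, ∑ i ∈ S \ B, if c ∈ V i \ V' i then 1 else 0 := by
        refine Finset.sum_le_sum fun c hc => ?_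
        have h1 := approvals_le_add_deleted V V' B c
        have h2 := hu c hc
        have h3 : (Finset.univ.filter fun i => i ∉ B ∧ c ∈ V i \ V' i).card ≤
            ((S \ B).filter fun i => c ∈ V i \ V' i).card := by
          refine Finset.card_le_card fun i hi => ?_
          simp only [Finset.mem_filter, Finset.mem_univ, true_and, Finset.mem_sdiff] at hi ⊢
          refine ⟨⟨?_, hi.1⟩, hi.2⟩
          by_contra hiS
          rw [hS i hiS] at hi
          exact hi.2.2 hi.2.1
        rw [← Finset.card_filter]
        omega
    _ = ∑ i ∈ S \ B, (J.filter fun c => c ∈ V i \ V' i).card := by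
        rw [Finset.sum_comm]
        simp only [Finset.card_filter]
    _ ≤ (S \ B).card * r := by
        refine (Finset.sum_le_card_nsmul _ _ r fun i _ => ?_).trans (by simp)
        exact (Finset.card_le_card fun c hc => (Finset.mem_filter.1 hc).2).trans (hr i)

end Combinatorics

theorem voteDist_of_subset {C : Type} [DecidableEq C] {v v' : Finset C} (h : v' ⊆ v) :
    voteDist v v' = (v \ v').card := by
  rw [voteDist, Finset.sdiff_eq_empty_iff_subset.2 h, Finset.card_empty, add_zero]

/-! ### Reduction of an instance to the Hall inequalities -/

namespace Instance

variable {n m : ℕ} (I : Instance n m)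

/-- The number of candidates that are not distinguished and have at least `T` approvals. -/
def above (T : ℕ) : ℕ :=
  (Finset.univ.filter fun c => c ∉ I.J ∧ T ≤ approvals I.votes ∅ c).card

/-- The total excess of the distinguished candidates over `u`, after removal of the voters in `B`. -/
def excess (u : ℕ) (B : Finset (Fin n)) : ℕ := ∑ c ∈ I.J, (approvals I.votes B c - u)

variable {I}

theorem isYes_of_excess_le {r T : ℕ} (hT : I.k ≤ I.above T) (h0 : T ≠ 0) {S : Finset (Fin n)}
    (hS : I.l ≤ S.card) (h : ∀ B ⊆ S, I.excess (T - 1) B ≤ (I.l - B.card) * r) : I.IsYes r := by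
  obtain ⟨S', hS', hcard⟩ := Finset.exists_subset_card_eq hS
  obtain ⟨V', hsub, hout, hJ, hr, hu⟩ := exists_deletion I.votes I.J S' r (T - 1)
    fun B hB => by rw [hcard]; exact h B (hB.trans hS')
  -- A bribed vote must change to a proper subset, so voters of `S'` who lose nothing count as not
  -- bribed.
  refine ⟨S'.filter fun i => V' i ≠ I.votes i, V',
    (Finset.card_filter_le _ _).trans hcard.le, fun i hi => ⟨?_, ?_⟩, fun i hi => ?_, ?_⟩
  · exact (hsub i).ssubset_of_ne (Finset.mem_filter.1 hi).2
  · rw [voteDist_of_subset (hsub i)]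
    exact hr i
  · by_cases hiS : i ∈ S'
    · simpa [hiS] using hi
    · exact hout i hiS
  · rw [forall_isWinningCommittee_iff V' (by simpa using I.k_le)]
    obtain ⟨W, hW, hWk⟩ := Finset.exists_subset_card_eq hT
    refine ⟨W, hWk, fun c hc d hd => ?_⟩
    obtain ⟨hdJ, hdT⟩ := (Finset.mem_filter.1 (hW hd)).2
    -- Deletions are confined to `J`, so a rival `d` keeps all its approvals.
    have hd' : approvals I.votes ∅ d ≤ approvals V' ∅ d := by
      refine Finset.card_le_card fun i hi => ?_
      simp only [Finset.mem_filter, Finset.mem_univ, true_and] at hi ⊢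
      refine ⟨hi.1, ?_⟩
      by_contra hn
      exact hdJ (hJ i (Finset.mem_sdiff.2 ⟨hi.2, hn⟩))
    have := hu c hc
    omega

/-- `T` is one more than the highest final score in `J`. The inequalities hold for every `u ≥ T -
1`, so they can be used with the maximal threshold in place of `T`. -/
theorem IsYes.exists_excess_le {r : ℕ} (h : I.IsYes r) :
    ∃ T ≤ n, T ≠ 0 ∧ I.k ≤ I.above T ∧ ∃ S : Finset (Fin n), I.l ≤ S.card ∧
      ∀ u, T - 1 ≤ u → ∀ B ⊆ S, I.excess u B ≤ (I.l - B.card) * r := by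
  obtain ⟨S, V', hS, hV, hout, hwin⟩ := h
  rw [forall_isWinningCommittee_iff V' (by simpa using I.k_le)] at hwin
  obtain ⟨W, hWk, hW⟩ := hwin
  have hsub : ∀ i, V' i ⊆ I.votes i := fun i => by
    by_cases hi : i ∈ S
    · exact (hV i hi).1.subset
    · rw [hout i hi]
  have hr : ∀ i, (I.votes i \ V' i).card ≤ r := fun i => by
    by_cases hi : i ∈ S
    · exact voteDist_of_subset (hsub i) ▸ (hV i hi).2
    · simp [hout i hi]
  have hle : ∀ c, approvals V' ∅ c ≤ approvals I.votes ∅ c := fun c => by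
    refine Finset.card_le_card fun i hi => ?_
    simp only [Finset.mem_filter, Finset.mem_univ, true_and] at hi ⊢
    exact ⟨hi.1, hsub i hi.2⟩
  obtain ⟨c₀, hc₀, hmax⟩ := Finset.exists_max_image I.J (approvals V' ∅) I.J_nonempty
  have habove : I.k ≤ I.above (approvals V' ∅ c₀ + 1) := by
    rw [← hWk]
    refine Finset.card_le_card fun d hd => ?_
    refine Finset.mem_filter.2 ⟨Finset.mem_univ _, fun hdJ => lt_irrefl _ (hW d hdJ d hd), ?_⟩
    exact (hW c₀ hc₀ d hd).trans_le (hle d)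
  -- The set of bribed voters is enlarged to size `l` by voters who delete nothing.
  obtain ⟨S', hSS', hS'⟩ := Finset.exists_superset_card_eq hS (by simpa using I.l_le)
  refine ⟨approvals V' ∅ c₀ + 1, ?_, by omega, habove, S', hS'.ge, fun u hu B hB => ?_⟩
  · have hne : W.Nonempty := by
      rw [← Finset.card_pos, hWk]; exact I.k_pos
    obtain ⟨d, hd⟩ := hne
    refine (hW c₀ hc₀ d hd).trans_le ((Finset.card_le_univ _).trans (by simp))
  · rw [← hS', ← Finset.card_sdiff_of_subset hB]
    refine sum_approvals_sub_le I.votes V' I.J S' (fun i hi => hout i fun h => hi (hSS' h)) hr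
      (fun c hc => ?_) B
    have := hmax c hc
    omega

/-- The characterization of yes-instances that the procedure tests. -/
theorem isYes_iff {r T : ℕ} (hmax : ∀ T' ≤ n, T < T' → I.above T' < I.k)
    (hT : T = 0 ∨ I.k ≤ I.above T) :
    I.IsYes r ↔ T ≠ 0 ∧ ∃ S : Finset (Fin n), I.l ≤ S.card ∧
      ∀ B ⊆ S, I.excess (T - 1) B ≤ (I.l - B.card) * r := by
  constructor
  · intro h
    obtain ⟨T', hn, h0, hab, S, hS, hex⟩ := h.exists_excess_le
    have hle : T' ≤ T := by
      by_contra hlt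
      have := hmax T' hn (by omega)
      omega
    exact ⟨by omega, S, hS, hex (T - 1) (by omega)⟩
  · rintro ⟨h0, S, hS, hex⟩
    exact isYes_of_excess_le (hT.resolve_left h0) h0 hS hex

/-- A vote has at most `m` approvals to lose. The cap matters for the running time: `r` is a single
input word and may be far larger than the input length. -/
theorem isYes_min (r : ℕ) : I.IsYes (min r m) ↔ I.IsYes r := by
  refine exists_congr fun S => exists_congr fun V' => and_congr_right fun _ =>
    and_congr_left fun _ => forall_congr' fun i => forall_congr' fun _ =>
      and_congr_right fun h => ?_
  rw [voteDist_of_subset h.subset, le_min_iff, and_iff_left]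
  exact (Finset.card_le_univ _).trans (by simp)

end Instance

end ApprovalBribery

/-! ### The procedure solves the problem -/

namespace ApprovalBribery

open RAM

theorem getElem?_flatMap_of_length {α β : Type} {f : α → List β} {m : ℕ}
    (hf : ∀ a, (f a).length = m) (L : List α) {i c : ℕ} (hc : c < m) :
    (L.flatMap f)[i * m + c]? = L[i]?.bind fun a => (f a)[c]? := by
  induction L generalizing i with
  | nil => simp
  | cons a L ih =>
    rw [List.flatMap_cons]
    rcases i with _ | i
    · rw [List.getElem?_append_left (by rw [hf]; omega)]
      simp
    · rw [List.getElem?_append_right (by rw [hf]; nlinarith), hf,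
        show (i + 1) * m + c - m = i * m + c by rw [Nat.succ_mul]; omega, ih]
      simp

/-! ### Agreement of the tables with the instance -/

namespace Instance

variable {n m : ℕ} (I : Instance n m)

theorem length_encode (r : ℕ) : (I.encode r).length = 5 + m + n * m := by
  simp [encode, List.length_flatMap]
  omega

/-- The membership tables of an instance. -/
def table (r : ℕ) : Table where
  n := n
  m := m
  k := I.k
  l := I.l
  r := min r m
  dist c := if ∃ h : c < m, ⟨c, h⟩ ∈ I.J then 1 else 0
  vote i c := if ∃ (hi : i < n) (hc : c < m), ⟨c, hc⟩ ∈ I.votes ⟨i, hi⟩ then 1 else 0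

theorem encode_dist (r : ℕ) {c : ℕ} (hc : c < m) :
    (I.encode r).getD (5 + c) 0 = (I.table r).dist c := by
  rw [encode, List.append_assoc, List.getD_append_right _ _ _ _ (by simp),
    List.getD_append _ _ _ _ (by simpa using hc), List.getD_eq_getElem _ _ (by simpa using hc)]
  simp [table, hc]

theorem encode_vote (r : ℕ) {i c : ℕ} (hi : i < n) (hc : c < m) :
    (I.encode r).getD (5 + m + i * m + c) 0 = (I.table r).vote i c := by
  rw [encode, List.getD_append_right _ _ _ _ (by simp; omega), List.getD_eq_getElem?_getD,
    show 5 + m + i * m + c - _ = i * m + c by simp; omega,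
    getElem?_flatMap_of_length (m := m) (by simp) _ hc]
  simp [table, hi, hc]

theorem bounded_table (r : ℕ) : (I.table r).Bounded (I.encode r).length := by
  -- With `m = 0` the input length would not bound `n`.
  have hm : 1 ≤ m := I.k_pos.trans I.k_le
  have hn : n ≤ n * m := Nat.le_mul_of_pos_right _ hm
  have hl := I.l_le
  rw [length_encode]
  have hr : min r m ≤ m := min_le_right _ _
  refine ⟨by omega, ?_, ?_, ?_, ?_⟩ <;> simp only [table] <;> omega

/-- The voters with a nonzero digit in `x`. -/
def voters (n x : ℕ) : Finset (Fin n) := Finset.univ.filter fun i => bits x i ≠ 0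

theorem mem_voters {x : ℕ} {i : Fin n} : i ∈ voters n x ↔ bits x i ≠ 0 := by simp [voters]

theorem exists_voters_eq (B : Finset (Fin n)) : ∃ x < 2 ^ n, voters n x = B := by
  refine ⟨Nat.ofBits fun i => decide (i ∈ B), Nat.ofBits_lt_two_pow _, ?_⟩
  ext i
  simp [mem_voters, bits, Nat.testBit_ofBits_lt]

theorem voters_subset_iff {x y : ℕ} :
    voters n y ⊆ voters n x ↔ ∀ i < n, bits y i ≤ bits x i := by
  simp only [Finset.subset_iff, mem_voters]
  constructor
  · intro h i hi
    have := @h ⟨i, hi⟩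
    have := bits_le_one y i
    simp only at *
    omega
  · intro h i hi
    have := h i i.2
    omega

theorem column_table (r : ℕ) {b : ℕ → ℕ} {B : Finset (Fin n)} (hb : ∀ i : Fin n, i ∈ B ↔ b i ≠ 0)
    (c : Fin m) : (I.table r).column b c = approvals I.votes B c := by
  rw [Table.column, approvals, Finset.card_filter]
  refine (Finset.sum_range _).trans (Finset.sum_congr rfl fun (i : Fin n) _ => ?_)
  simp [table, hb]

theorem above_table (r T : ℕ) : (I.table r).above T = I.above T := by
  rw [Table.above, above, Finset.card_filter]
  refine (Finset.sum_range _).trans (Finset.sum_congr rfl fun (c : Fin m) _ => ?_)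
  rw [I.column_table r (B := ∅) (by simp) c]
  simp [table]

theorem slack_table (r x : ℕ) : (I.table r).slack (bits x) = I.l - (voters n x).card := by
  rw [Table.slack, voters, Finset.card_filter]
  refine congrArg (I.l - ·) ((Finset.sum_range _).trans (Finset.sum_congr rfl fun (i : Fin n) _ => ?_))
  simp

theorem excess_table (r u x : ℕ) :
    (I.table r).excess u (bits x) = I.excess u (voters n x) := by
  rw [Table.excess, excess, ← Finset.univ_inter I.J, ← Finset.sum_ite_mem]
  refine (Finset.sum_range _).trans (Finset.sum_congr rfl fun (c : Fin m) _ => ?_)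
  rw [I.column_table r (fun i => mem_voters) c]
  simp [table]

/-- Slack and defect are truncated differences, so their vanishing expresses the two inequalities;
indices below `2 ^ n` run through all sets of voters. -/
theorem good_table_iff (r u x : ℕ) : (I.table r).Good u x ↔ I.l ≤ (voters n x).card ∧
    ∀ B ⊆ voters n x, I.excess u B ≤ (I.l - B.card) * min r m := by
  simp only [Table.Good, Table.defect, slack_table, excess_table, Nat.sub_eq_zero_iff_le]
  refine and_congr_right fun _ => ⟨fun h B hB => ?_, fun h y _ hyx => ?_⟩
  · obtain ⟨y, hy, rfl⟩ := exists_voters_eq B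
    exact h y hy (voters_subset_iff.1 hB)
  · exact h _ (voters_subset_iff.2 hyx)

theorem isYes_iff_good {r T : ℕ} (hT : (I.table r).IsThreshold T) :
    I.IsYes r ↔ T ≠ 0 ∧ ∃ x < 2 ^ n, (I.table r).Good (T - 1) x := by
  obtain ⟨-, hmax, h⟩ := hT
  simp only [above_table] at hmax h
  rw [← isYes_min, isYes_iff (I := I) (r := min r m) hmax h]
  refine and_congr_right fun _ => ?_
  simp only [good_table_iff]
  constructor
  · rintro ⟨S, hS⟩
    obtain ⟨x, hx, rfl⟩ := exists_voters_eq S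
    exact ⟨x, hx, hS⟩
  · rintro ⟨x, -, hx⟩
    exact ⟨_, hx⟩

end Instance

/-! ### Reading the input and the total running time -/

/-- Read the parameters, and cap the bound on deletions at the number of candidates. -/
def readInput : Program :=
  .instr (.const 7 0) ;; .instr (.load 1 0 7) ;; .instr (.inc 7) ;; .instr (.load 2 0 7) ;;
    .instr (.inc 7) ;; .instr (.load 3 0 7) ;; .instr (.inc 7) ;; .instr (.load 4 0 7) ;;
    .instr (.inc 7) ;; .instr (.load 5 0 7) ;; .ite (.lt 2 5) (.instr (.copy 5 2)) .skip

theorem readInput_spec {n m : ℕ} (I : Instance n m) (r : ℕ) :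
    Tri readInput (initState (I.encode r)) 12 (I.table r).Env := by
  have key : ∀ s : State, s.reg 1 = n → s.reg 2 = m → s.reg 3 = I.k → s.reg 4 = I.l →
      s.reg 5 = min r m → s.reg 14 = 0 → s.mem 0 = (fun i => (I.encode r).getD i 0) →
      (I.table r).Env s := by
    intro s h1 h2 h3 h4 h5 h14 hm
    exact ⟨h1, h2, h3, h4, h5, h14, fun c hc => by rw [hm]; exact I.encode_dist r hc,
      fun i hi c hc => by rw [hm]; exact I.encode_vote r hi hc⟩
  refine Tri.cons (Tri.cons (Tri.cons (Tri.cons (Tri.cons (Tri.cons (Tri.cons (Tri.cons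
    (Tri.cons (Tri.cons (Tri.ite (T := 1) (fun h => ?_) (fun h => ?_)))))))))))
  · refine Tri.instr (key _ ?_ ?_ ?_ ?_ ?_ ?_ ?_) <;>
      simp [Instr.exec, initState, Instance.encode, Test.Holds] at h ⊢
    omega
  · refine Tri.skip (key _ ?_ ?_ ?_ ?_ ?_ ?_ ?_) <;>
      simp [Instr.exec, initState, Instance.encode, Test.Holds] at h ⊢
    omega

end ApprovalBribery

open RAM ApprovalBribery in
theorem ApprovalBribery.decidesWithin {n m : ℕ} (I : Instance n m) (r : ℕ) :
    DecidesWithin (readInput ;; Table.solve) (I.encode r) (I.IsYes r)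
      (2 ^ n * (320 * (I.encode r).length ^ 5)) := by
  classical
  have hD := I.bounded_table r
  set N := (I.encode r).length with hN
  have hn : 1 ≤ (I.table r).n := I.l_pos.trans I.l_le
  have h := (readInput_spec I r).seq (P' := Table.solve) (T' := 2 ^ n * (300 * N ^ 5))
    fun s a he => Table.solve_spec hD he hn (by rw [a.reg 0 rfl]; rfl)
      (by rw [a.mem 1 rfl]; exact fun _ => rfl)
  obtain ⟨s, t, hr, ht, T, hT, hs⟩ := h
  have hiff := I.isYes_iff_good hT
  refine ⟨s, t, hr, ht.trans ?_, fun hA => ?_, fun hA => ?_⟩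
  -- The at most `12` steps of reading fit into the margin between the factors `300` and `320`.
  · have h1 : 1 ≤ 2 ^ n * N ^ 5 := Nat.mul_pos (by positivity) (Nat.pow_pos hD.one)
    linarith
  · rw [hs]; exact if_pos (hiff.1 hA)
  · rw [hs]; exact if_neg fun h => hA (hiff.2 h)

theorem mainTheorem8 :
    ∃ (P : RAM.Program) (p : Polynomial ℕ),
      ∀ (r n m : ℕ) (I : ApprovalBribery.Instance n m),
        RAM.DecidesWithin P (I.encode r) (I.IsYes r)
          (2 ^ n * p.eval (I.encode r).length) := by
  refine ⟨.seq ApprovalBribery.readInput ApprovalBribery.Table.solve,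
    Polynomial.C 320 * Polynomial.X ^ 5, fun r n m I => ?_⟩
  simpa using ApprovalBribery.decidesWithin I r
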